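/- Let $\mathcal S$ be one of the following categories of spaces: simplicial sets, compactly generated topological spaces, or $\Delta$-generated (also called $I$-generated) topological spaces. Let $D$ be a small category and let $\mathcal S^D$ be the category of $D$-diagrams in $\mathcal S$. For diagrams $X,Y$ let $\hom(X,Y)$ be the simplicial function complex, whose $n$-simplices are the natural transformations $\Delta^n\times X\to Y$; let $\ast$ be the terminal diagram. A diagram $T$ is an *orbit* if $\operatorname{colim}_D T$ is a point, and a *regular* orbit if moreover there is a map $\ast\to T$. In the equivariant model structure, a map $f$ of diagrams is a weak equivalence (resp. fibration) if $\hom(T,f)$ is a weak equivalence (resp. Kan fibration) of simplicial sets for every orbit $T$, and cofibrations are the maps with the left lifting property with respect to all fibrations that are weak equivalences. A diagram $Z$ is *contractible* if $Z\to\ast$ is a weak equivalence, and a simplicial set is contractible if its map to the point is a weak equivalence. A *fibrant replacement* of a map $f\colon X\to Y$ is a map $\hat f\colon\hat X\to\hat Y$ of fibrant diagrams together with weak equivalences $i\colon X\to\hat X$ and $j\colon Y\to\hat Y$ such that $\hat f i=jf$. For a set $B$ of cofibrant diagrams, a map $f$ of diagrams is a *$B$-colocal equivalence* if for every fibrant replacement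 $\hat f$ of $f$ and every $b\in B$ the map $\hom(b,\hat f)$ is a weak equivalence of simplicial sets. A diagram $C$ is *$B$-colocal* if it is cofibrant and, for every $B$-colocal equivalence $g$ and every fibrant replacement $\hat g$ of $g$, the map $\hom(C,\hat g)$ is a weak equivalence of simplicial sets. **Lemma.** Let $B$ be a (small) set of cofibrant diagrams in $\mathcal S^D$ such that a fibrant diagram $Z$ is contractible if and only if the simplicial set $\hom(b,Z)$ is contractible for every $b\in B$. Then every regular orbit $T$ in $\mathcal S^D$ is $B$-colocal. -/

import Mathlib

open CategoryTheory Limits MonoidalCategory HomotopicalAlgebra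

universe u

/-! ### Simplicial sets -/

/-- A map of simplicial sets is a Kan fibration if it has the right lifting property with respect
to all horn inclusions. -/
def SSet.IsKanFibration {K L : SSet.{u}} (f : K ⟶ L) : Prop :=
  SSet.modelCategoryQuillen.J.rlp f

open SSet.modelCategoryQuillen in
/-- A map `f : K ⟶ L` of simplicial sets is a weak equivalence if for every Kan complex `M`
precomposition with `f` is a bijection from homotopy classes of maps `L ⟶ M`
to homotopy classes of maps `K ⟶ M`. (Since `M` is a Kan complex, simplicial homotopy is an
equivalence relation on these sets of maps; `surj` and `inj` are surjectivity and injectivity.) -/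
structure SSet.IsWeakEquivalence {K L : SSet.{u}} (f : K ⟶ L) : Prop where
  surj : ∀ (M : SSet.{u}) [SSet.KanComplex M] (a : K ⟶ M),
    ∃ b : L ⟶ M, Nonempty (SSet.Homotopy (f ≫ b) a)
  inj : ∀ (M : SSet.{u}) [SSet.KanComplex M] (b b' : L ⟶ M),
    Nonempty (SSet.Homotopy (f ≫ b) (f ≫ b')) → Nonempty (SSet.Homotopy b b')

/-- A simplicial set is contractible if its map to the point is a weak equivalence. -/
def SSet.IsContractible (K : SSet.{u}) : Prop :=
  SSet.IsWeakEquivalence (terminal.from K)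

/-! ### Categories of spaces -/

/-- The data from which simplicial function complexes of a category `𝒮` of spaces are formed: the
inclusion of `𝒮` in an ambient category (simplicial sets or all topological spaces), and the
functor sending `[n]` and `X` to the product of the `n`-simplex with `X`. Only the three instances
below are used. -/
class SpaceCategory (𝒮 : Type (u + 1)) [LargeCategory.{u} 𝒮] where
  /-- The ambient category. -/
  Amb : Type (u + 1)
  [ambCategory : LargeCategory.{u} Amb]
  /-- The inclusion in the ambient category. -/
  incl : 𝒮 ⥤ Amb
  /-- `([n], X) ↦ Δ^n × X`. -/
  simplexProd : SimplexCategory ⥤ 𝒮 ⥤ Amb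

attribute [instance, reducible] SpaceCategory.ambCategory

/-- Simplicial sets, with `Δ[n] × X` the product of simplicial sets. -/
noncomputable instance : SpaceCategory SSet.{u} where
  Amb := SSet.{u}
  incl := 𝟭 _
  simplexProd := SSet.stdSimplex ⋙ curriedTensor SSet.{u}

/-- Compactly generated spaces. The topological `n`-simplex is compact Hausdorff, so the ordinary
product `Δ^n × X` is compactly generated when `X` is, and it is the product
in compactly generated spaces. -/
noncomputable instance : SpaceCategory CompactlyGenerated.{u, u} where
  Amb := TopCat.{u}
  incl := CompactlyGenerated.compactlyGeneratedToTop
  simplexProd := SimplexCategory.toTop.{u} ⋙ curriedTensor TopCat.{u} ⋙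
    (Functor.whiskeringLeft _ _ _).obj CompactlyGenerated.compactlyGeneratedToTop

/-- Delta-generated (also called `I`-generated) spaces. The topological `n`-simplex is compact
Hausdorff and delta-generated, so the ordinary product `Δ^n × X` is delta-generated when `X` is,
and it is the product in delta-generated spaces. -/
noncomputable instance : SpaceCategory DeltaGenerated.{u} where
  Amb := TopCat.{u}
  incl := DeltaGenerated.deltaGeneratedToTop
  simplexProd := SimplexCategory.toTop.{u} ⋙ curriedTensor TopCat.{u} ⋙
    (Functor.whiskeringLeft _ _ _).obj DeltaGenerated.deltaGeneratedToTop

namespace SpaceDiagram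

variable {D : Type u} [SmallCategory D] {𝒮 : Type (u + 1)} [LargeCategory.{u} 𝒮]
  [SpaceCategory.{u} 𝒮]

/-- The simplicial function complex `hom(X, Y)` of two `D`-diagrams of spaces: its `n`-simplices
are the natural transformations `Δ^n × X ⟶ Y`. -/
def funComplex (X Y : D ⥤ 𝒮) : SSet.{u} where
  obj n := X ⋙ SpaceCategory.simplexProd.obj n.unop ⟶ Y ⋙ SpaceCategory.incl
  map θ := ↾fun φ ↦ Functor.whiskerLeft X (SpaceCategory.simplexProd.map θ.unop) ≫ φ
  map_id n := by
    ext φ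
    simp
  map_comp θ θ' := by
    ext φ
    simp

/-- The map `hom(A, f) : hom(A, X) ⟶ hom(A, Y)` induced by `f : X ⟶ Y`. -/
def funComplexMap (A : D ⥤ 𝒮) {X Y : D ⥤ 𝒮} (f : X ⟶ Y) : funComplex A X ⟶ funComplex A Y where
  app n := ↾fun φ ↦ φ ≫ Functor.whiskerRight f SpaceCategory.incl
  naturality n m θ := by
    ext φ
    exact Category.assoc _ _ _

/-- An orbit is a diagram whose colimit is a point. -/
def IsOrbit {D : Type u} [SmallCategory D] {𝒮 : Type (u + 1)} [LargeCategory.{u} 𝒮]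
    (T : D ⥤ 𝒮) : Prop :=
  ∃ c : Cocone T, Nonempty (IsColimit c) ∧ Nonempty (IsTerminal c.pt)

/-- An orbit `T` is regular if it admits a map from the terminal diagram. -/
def IsRegularOrbit {D : Type u} [SmallCategory D] {𝒮 : Type (u + 1)} [LargeCategory.{u} 𝒮]
    (T : D ⥤ 𝒮) : Prop :=
  IsOrbit T ∧ ∃ P : D ⥤ 𝒮, Nonempty (IsTerminal P) ∧ Nonempty (P ⟶ T)

/-- Weak equivalences of the equivariant model structure. -/
def IsWeakEquivalence {X Y : D ⥤ 𝒮} (f : X ⟶ Y) : Prop :=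
  ∀ T : D ⥤ 𝒮, IsOrbit T → SSet.IsWeakEquivalence (funComplexMap T f)

/-- Fibrations of the equivariant model structure. -/
def IsFibration {X Y : D ⥤ 𝒮} (f : X ⟶ Y) : Prop :=
  ∀ T : D ⥤ 𝒮, IsOrbit T → SSet.IsKanFibration (funComplexMap T f)

/-- Cofibrations of the equivariant model structure: the maps with the left lifting property with
respect to all fibrations that are weak equivalences. -/
def IsCofibration {X Y : D ⥤ 𝒮} (i : X ⟶ Y) : Prop :=
  ∀ ⦃E F : D ⥤ 𝒮⦄ (p : E ⟶ F), IsFibration p → IsWeakEquivalence p → HasLiftingProperty i p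

/-- `X` is cofibrant if the map from the initial diagram to `X` is a cofibration. -/
def IsCofibrant (X : D ⥤ 𝒮) : Prop :=
  ∃ (I : D ⥤ 𝒮) (hI : IsInitial I), IsCofibration (hI.to X)

/-- `X` is fibrant if the map from `X` to the terminal diagram is a fibration. -/
def IsFibrant (X : D ⥤ 𝒮) : Prop :=
  ∃ (P : D ⥤ 𝒮) (hP : IsTerminal P), IsFibration (hP.from X)

/-- `X` is contractible if the map from `X` to the terminal diagram is a weak equivalence. -/
def IsContractible (X : D ⥤ 𝒮) : Prop :=
  ∃ (P : D ⥤ 𝒮) (hP : IsTerminal P), IsWeakEquivalence (hP.from X)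

/-- `f'` is a fibrant replacement of the map `f`: there is a commutative square with horizontal
maps `f` and `f'`, whose vertical maps are weak equivalences to fibrant diagrams. -/
def IsFibrantReplacement {X Y X' Y' : D ⥤ 𝒮} (f : X ⟶ Y) (f' : X' ⟶ Y') : Prop :=
  IsFibrant X' ∧ IsFibrant Y' ∧ ∃ (i : X ⟶ X') (j : Y ⟶ Y'),
    IsWeakEquivalence i ∧ IsWeakEquivalence j ∧ i ≫ f' = f ≫ j

/-- `f` is an `A`-colocal equivalence. -/
def IsColocalEquivalence (A : Set (D ⥤ 𝒮)) {X Y : D ⥤ 𝒮} (f : X ⟶ Y) : Prop :=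
  ∀ ⦃X' Y' : D ⥤ 𝒮⦄ (f' : X' ⟶ Y'), IsFibrantReplacement f f' →
    ∀ a ∈ A, SSet.IsWeakEquivalence (funComplexMap a f')

/-- The diagram `C` is `A`-colocal. -/
def IsColocal (A : Set (D ⥤ 𝒮)) (C : D ⥤ 𝒮) : Prop :=
  IsCofibrant C ∧ ∀ ⦃X Y : D ⥤ 𝒮⦄ (g : X ⟶ Y), IsColocalEquivalence A g →
    ∀ ⦃X' Y' : D ⥤ 𝒮⦄ (g' : X' ⟶ Y'), IsFibrantReplacement g g' →
      SSet.IsWeakEquivalence (funComplexMap C g')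

/-- A fibrant diagram `Z` is contractible if and only if `hom(b, Z)` is contractible for all `b`
in `B`. -/
def DetectsContractibility (B : Set (D ⥤ 𝒮)) : Prop :=
  ∀ Z : D ⥤ 𝒮, IsFibrant Z → (IsContractible Z ↔ ∀ b ∈ B, (funComplex b Z).IsContractible)

end SpaceDiagram

/-! The hypothesis is so strong that every regular orbit `T` is trivial: each `T(d)` is a point.
Moreover some `b` in `B` admits a map from the terminal diagram. Then `T` is a retract of `b`, so
`hom(T, g')` is a retract of `hom(b, g')`, and `T` inherits colocality. Cofibrancy of `T` holds
because orbits detect acyclic fibrations.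

Both facts come from test diagrams `Z` that are fibrant and have `hom(b, Z)` contractible for every
`b` in `B`. Such a `Z` is contractible, so `hom(U, Z)` is nonempty and connected for every orbit
`U`; maps to constant simplicial sets are enough to see this.

A point of some `b`: let `Z` be indiscrete on the coproduct of the underlying sets of the members of
`B`. It receives each `b`, so it receives `T`. As `T` is connected, its point lands in a single
summand.

Triviality of `T`: suppose `T` has an element other than its base point. Let `c` be an infinite
cardinal bounding the members of `B`, and let `W` be the wedge of copies of the underlying pointed
diagram of sets of `T` (one simplicial degree of it in the simplicial case), indexed by a set of
more than `c` elements. Take `Z` to consist of `W` with additional paths labelled by subsets `A` of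
the index set with at most `c` elements; a path labelled `A` is only available to elements supported
in `A`, and the maps of `D` preserve labels. The image of a map from `b` involves at most `c`
indices, so one label serves for all of it and `hom(b, Z)` contracts. But `W` itself, made discrete,
is an orbit. Along a path in `hom(W, Z)` connectedness forces a common label for all elements, and
no label contains all supports, so the tautological map cannot be joined to a constant one. This
contradicts connectedness of `hom(W, Z)`.

In simplicial sets `Z` is a complex of labelled graphs (`LabelledRel.diagram`, with
`subsingleton_of_detectsContractibility_sset`). For spaces it is the Alexandrov-discrete `telescope`
(`isContractible_continuousComplex_telescope`, `exists_hom_constant_ne`), and the two topological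
categories are handled together through `TopSpaces`. -/

section

open Opposite Simplicial

namespace SSet

/-! ### Homotopies and weak equivalences of simplicial sets -/

/-- Constructor for homotopies. -/
noncomputable def Homotopy.mk' {X Y : SSet.{u}} {f g : X ⟶ Y} (h : X ⊗ Δ[1] ⟶ Y)
    (h₀ : ι₀ ≫ h = f) (h₁ : ι₁ ≫ h = g) : Homotopy f g where
  h := h
  h₀ := h₀
  h₁ := h₁
  rel := by
    ext n x
    exact x.1.2.elim

/-- Precomposition of a homotopy with a map. -/
noncomputable def Homotopy.whiskerLeft {X Y Z : SSet.{u}} {f g : Y ⟶ Z} (H : Homotopy f g)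
    (k : X ⟶ Y) : Homotopy (k ≫ f) (k ≫ g) :=
  Homotopy.mk' (k ▷ _ ≫ H.h) (by rw [ι₀_comp_assoc, H.h₀]) (by rw [ι₁_comp_assoc, H.h₁])

/-- Postcomposition of a homotopy with a map. -/
noncomputable def Homotopy.whiskerRight {X Y Z : SSet.{u}} {f g : X ⟶ Y} (H : Homotopy f g)
    (k : Y ⟶ Z) : Homotopy (f ≫ k) (g ≫ k) :=
  Homotopy.mk' (H.h ≫ k) (by rw [H.h₀_assoc]) (by rw [H.h₁_assoc])

/-- The constant homotopy. -/
noncomputable def Homotopy.ofEq {X Y : SSet.{u}} {f g : X ⟶ Y} (h : f = g) : Homotopy f g :=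
  Homotopy.mk' (SemiCartesianMonoidalCategory.fst _ _ ≫ f) (by rw [← Category.assoc, ι₀_fst, Category.id_comp])
    (by rw [← Category.assoc, ι₁_fst, Category.id_comp, h])

/-- Weak equivalences are stable under retracts. -/
lemma IsWeakEquivalence.of_retract {K L K' L' : SSet.{u}} {f : K ⟶ L} {f' : K' ⟶ L'}
    (hf : IsWeakEquivalence f') (iK : K ⟶ K') (rK : K' ⟶ K) (iL : L ⟶ L') (rL : L' ⟶ L)
    (hK : iK ≫ rK = 𝟙 K) (hL : iL ≫ rL = 𝟙 L) (hi : f ≫ iL = iK ≫ f') (hr : f' ≫ rL = rK ≫ f) :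
    IsWeakEquivalence f where
  surj M _ a := by
    obtain ⟨b, ⟨H⟩⟩ := hf.surj M (rK ≫ a)
    refine ⟨iL ≫ b, ⟨?_⟩⟩
    have H' := H.whiskerLeft iK
    rwa [reassoc_of% hK, ← reassoc_of% hi] at H'
  inj M _ b b' := by
    rintro ⟨H⟩
    have H' := H.whiskerLeft rK
    rw [← reassoc_of% hr, ← reassoc_of% hr] at H'
    obtain ⟨G⟩ := hf.inj M _ _ ⟨H'⟩
    have G' := G.whiskerLeft iL
    rw [reassoc_of% hL, reassoc_of% hL] at G'
    exact ⟨G'⟩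

lemma isContractible_of_homotopy {K : SSet.{u}} (v : K _⦋0⦌)
    (H : Homotopy (SSet.const v) (𝟙 K)) : K.IsContractible where
  surj M _ a := ⟨SSet.const v ≫ a, ⟨by
    have H' := H.whiskerRight a
    rwa [Category.id_comp, ← comp_const (terminal.from K), Category.assoc] at H'⟩⟩
  inj M _ b b' := by
    rintro ⟨H⟩
    have H' := H.whiskerLeft (SSet.const v : ⊤_ SSet.{u} ⟶ K)
    have e : (SSet.const v : ⊤_ SSet.{u} ⟶ K) ≫ terminal.from K = 𝟙 _ := Subsingleton.elim _ _
    rw [reassoc_of% e, reassoc_of% e] at H'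
    exact ⟨H'⟩

/-- A simplicial set is contractible if it admits a natural contraction `c x σ`, where
`σ : [n] ⟶ [1]` is thought of as a simplex of the interval. -/
lemma isContractible_of_contraction {K : SSet.{u}} (v : K _⦋0⦌)
    (c : ∀ n : SimplexCategoryᵒᵖ, K.obj n → (n.unop ⟶ ⦋1⦌) → K.obj n)
    (map_c : ∀ {n m : SimplexCategoryᵒᵖ} (θ : n ⟶ m) (x : K.obj n) (σ : n.unop ⟶ ⦋1⦌),
      K.map θ (c n x σ) = c m (K.map θ x) (θ.unop ≫ σ))
    (c_zero : ∀ n x, c n x (SimplexCategory.const _ _ 0) = (SSet.const v : K ⟶ K).app n x)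
    (c_one : ∀ n x, c n x (SimplexCategory.const _ _ 1) = x) : K.IsContractible := by
  refine isContractible_of_homotopy v (Homotopy.mk'
    { app := fun n ↦ ↾fun x ↦ c n x.1 (stdSimplex.objEquiv x.2)
      naturality := ?_ } ?_ ?_)
  · intro n m θ
    ext x
    exact (map_c θ x.1 (stdSimplex.objEquiv x.2)).symm
  · ext n x
    exact c_zero n x
  · ext n x
    exact c_one n x

/-! ### Constant simplicial sets -/

/-- The constant simplicial set on a type. -/
def constant (Q : Type u) : SSet.{u} where
  obj _ := Q
  map _ := 𝟙 _

/-- A map to a constant simplicial set. -/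
def toConstant {K : SSet.{u}} {Q : Type u} (q : ∀ n, K.obj n → Q)
    (hq : ∀ {n m} (θ : n ⟶ m) (x : K.obj n), q m (K.map θ x) = q n x) : K ⟶ constant Q where
  app n := ↾(q n)
  naturality n m θ := by
    ext x
    exact hq θ x

lemma constant_app_map {K : SSet.{u}} {Q : Type u} (f : K ⟶ constant Q) {n m} (θ : n ⟶ m)
    (x : K.obj n) : (f.app m (K.map θ x) : Q) = f.app n x :=
  ConcreteCategory.congr_hom (f.naturality θ) x

/-- The degenerate edge at `x` paired with the nondegenerate edge of `Δ[1]` joins the two copies of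
`x` in the cylinder, and a map to a constant simplicial set takes one value on an edge and its
endpoints. Vertices suffice, since each simplex has the value of its first vertex. -/
lemma eq_of_homotopy_constant {K : SSet.{u}} {Q : Type u} {f g : K ⟶ constant Q}
    (H : Homotopy f g) : f = g := by
  have key : ∀ x : K _⦋0⦌, (f.app _ x : Q) = g.app _ x := fun x ↦ by
    let e : (K ⊗ Δ[1] : SSet.{u}) _⦋1⦌ :=
      (K.map (SimplexCategory.σ 0).op x, stdSimplex.objEquiv.symm (𝟙 _))
    have h₀ := constant_app_map H.h (SimplexCategory.δ 1).op e
    have h₁ := constant_app_map H.h (SimplexCategory.δ 0).op e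
    have e₀ : (K ⊗ Δ[1] : SSet.{u}).map (SimplexCategory.δ 1).op e = ι₀.app _ x := by
      refine Prod.ext ?_ ?_
      · exact SSet.δ_comp_σ_succ_apply 0 x
      · ext i; fin_cases i; rfl
    have e₁ : (K ⊗ Δ[1] : SSet.{u}).map (SimplexCategory.δ 0).op e = ι₁.app _ x := by
      refine Prod.ext ?_ ?_
      · exact SSet.δ_comp_σ_self_apply 0 x
      · ext i; fin_cases i; rfl
    rw [e₀] at h₀
    rw [e₁] at h₁
    have f₀ := ConcreteCategory.congr_hom (congr_app H.h₀ (op ⦋0⦌)) x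
    have f₁ := ConcreteCategory.congr_hom (congr_app H.h₁ (op ⦋0⦌)) x
    exact f₀.symm.trans (h₀.trans (h₁.symm.trans f₁))
  ext n x
  have := key (K.map (SimplexCategory.const ⦋0⦌ n.unop 0).op x)
  rwa [constant_app_map, constant_app_map] at this

/-! ### Horn fillings -/

/-- The horn filling condition. -/
def HasHornFilling (X : SSet.{u}) : Prop :=
  ∀ (n : ℕ) (i : Fin (n + 2)) (a : (Λ[n + 1, i] : SSet.{u}) ⟶ X),
    ∃ b : Δ[n + 1] ⟶ X, Λ[n + 1, i].ι ≫ b = a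

lemma HasHornFilling.isKanFibration {X Y : SSet.{u}} (hX : HasHornFilling X)
    (hY : ∀ n, Subsingleton (Y.obj n)) (f : X ⟶ Y) : IsKanFibration f := by
  intro _ _ _ hf
  simp only [modelCategoryQuillen.J, MorphismProperty.iSup_iff] at hf
  obtain ⟨n, ⟨i⟩⟩ := hf
  refine ⟨fun {t _} _ ↦ ?_⟩
  obtain ⟨b, hb⟩ := hX n i t
  exact ⟨⟨{ l := b
            fac_left := hb
            fac_right := by
              ext k x
              exact (hY k).elim _ _ }⟩⟩

lemma HasHornFilling.kanComplex {X : SSet.{u}} (hX : HasHornFilling X) : KanComplex X :=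
  KanComplex.iff.2 fun n i f hf ↦ by
    obtain ⟨b, hb⟩ := hX n i hf.desc
    refine ⟨b, fun j hj ↦ ?_⟩
    rw [← horn.ι_ι i j hj, Category.assoc, hb, horn.IsCompatible.ι_desc]

lemma HasHornFilling.of_iso {X Y : SSet.{u}} (hX : HasHornFilling X) (e : X ≅ Y) :
    HasHornFilling Y := fun n i a ↦ by
  obtain ⟨b, hb⟩ := hX n i (a ≫ e.inv)
  exact ⟨b ≫ e.hom, by rw [← Category.assoc, hb, Category.assoc, e.inv_hom_id, Category.comp_id]⟩

/-- The vertex of a horn which lies on every face of the horn. -/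
def horn.vertex (n : ℕ) (i : Fin (n + 2)) : (Λ[n + 1, i] : SSet.{u}) _⦋0⦌ :=
  ⟨stdSimplex.obj₀Equiv.symm i, by
    obtain ⟨j, hj⟩ := exists_ne i
    rw [mem_horn_iff_notMem_range]
    exact ⟨j, hj, by rintro ⟨_, rfl⟩; exact hj rfl⟩⟩

/-- All faces of the horn share the vertex `i`, so a map to a constant simplicial set has a single
value on the whole horn. -/
lemma hasHornFilling_constant (Q : Type u) : HasHornFilling (constant Q) := fun n i a ↦ by
  refine ⟨toConstant (fun _ _ ↦ a.app _ (horn.vertex n i)) (fun _ _ ↦ rfl), ?_⟩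
  refine horn.hom_ext _ _ fun j hj ↦ ?_
  obtain ⟨k, hk⟩ := Fin.exists_succAbove_eq hj.symm
  have := constant_app_map a (SimplexCategory.const ⦋0⦌ ⦋n⦌ k).op (horn.face i j hj)
  refine Eq.trans (congrArg (a.app _) ?_) this
  apply Subtype.ext
  ext l
  exact congrArg Fin.val hk.symm

instance (Q : Type u) : KanComplex (constant Q) := (hasHornFilling_constant Q).kanComplex

/-! ### Weak equivalences and Kan fibrations on connected components -/

namespace IsWeakEquivalence

variable {K L : SSet.{u}} {f : K ⟶ L} (hf : IsWeakEquivalence f)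
include hf

lemma exists_factor_constant {Q : Type u} (a : K ⟶ constant Q) :
    ∃ b : L ⟶ constant Q, f ≫ b = a := by
  obtain ⟨b, ⟨H⟩⟩ := hf.surj _ a
  exact ⟨b, eq_of_homotopy_constant H⟩

lemma hom_constant_ext {Q : Type u} {b b' : L ⟶ constant Q} (h : f ≫ b = f ≫ b') : b = b' := by
  obtain ⟨H⟩ := hf.inj _ b b' ⟨Homotopy.ofEq h⟩
  exact eq_of_homotopy_constant H

/-- If the target of a weak equivalence has a vertex, then so does the source. -/
lemma nonempty_vertex (y : L _⦋0⦌) : Nonempty (K _⦋0⦌) := by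
  by_contra hK
  rw [not_nonempty_iff] at hK
  -- If `K` has no vertex it is empty, so the constant maps `True` and `False` on `L` agree after
  -- restriction to `K`.
  have := hf.hom_constant_ext
    (b := toConstant (fun _ _ ↦ ULift.up True) (fun _ _ ↦ rfl))
    (b' := toConstant (fun _ _ ↦ ULift.up False) (fun _ _ ↦ rfl)) (by
      ext n x
      exact (hK.false (K.map (SimplexCategory.const ⦋0⦌ n.unop 0).op x)).elim)
  have h := congrArg ULift.down (ConcreteCategory.congr_hom (congr_app this _) y)
  exact cast h trivial

lemma app_constant_eq (hL : Subsingleton (L _⦋0⦌)) {Q : Type u} (a : K ⟶ constant Q)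
    (x y : K _⦋0⦌) : (a.app _ x : Q) = a.app _ y := by
  obtain ⟨b, rfl⟩ := hf.exists_factor_constant a
  exact congrArg (b.app _) (hL.elim (f.app _ x) (f.app _ y))

end IsWeakEquivalence

lemma map_const_zero (K : SSet.{u}) (x : K _⦋0⦌) :
    K.map (SimplexCategory.const ⦋0⦌ ⦋0⦌ 0).op x = x := by
  have : (SimplexCategory.const ⦋0⦌ ⦋0⦌ 0) = 𝟙 _ := by
    ext i
    fin_cases i
    rfl
  rw [this, op_id, Functor.map_id_apply]

lemma const_app_zero {K L : SSet.{u}} (y : L _⦋0⦌) (x : K _⦋0⦌) :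
    (SSet.const y : K ⟶ L).app _ x = y :=
  map_const_zero L y

/-- Kan fibrations have the right lifting property with respect to the endpoints of edges. -/
lemma IsKanFibration.exists_edge {K L : SSet.{u}} {f : K ⟶ L} (hf : IsKanFibration f)
    (i j : Fin 2) (hij : j ≠ i) (e : L _⦋1⦌) (x : K _⦋0⦌)
    (hx : f.app _ x = L.map (SimplexCategory.δ j).op e) :
    ∃ e' : K _⦋1⦌, f.app _ e' = e ∧ K.map (SimplexCategory.δ j).op e' = x := by
  have hlift := hf _ (modelCategoryQuillen.horn_ι_mem_J 1 i)
  -- A horn in `Δ[1]` has a single face, a vertex, so maps out of it are compared there.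
  have hhorn : ∀ g : (Λ[1, i] : SSet.{u}) ⟶ L, ∀ g', g.app _ (horn.face i j hij) =
      g'.app _ (horn.face i j hij) → g = g' := fun g g' h ↦ by
    refine horn.hom_ext _ _ fun k hk ↦ ?_
    obtain rfl : k = j := by omega
    exact h
  have sq : CommSq (SSet.const x : (Λ[1, i] : SSet.{u}) ⟶ K) (Λ[1, i]).ι f
      (yonedaEquiv.symm e) := ⟨hhorn _ _ (by
        refine Eq.trans (congrArg (f.app _) (const_app_zero x _)) (hx.trans ?_)
        rfl)⟩
  refine ⟨yonedaEquiv sq.lift, ?_, ?_⟩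
  · rw [← yonedaEquiv_comp, sq.fac_right, Equiv.apply_symm_apply]
  · have h := ConcreteCategory.congr_hom (congr_app sq.fac_left (op ⦋0⦌)) (horn.face i j hij)
    refine Eq.trans ?_ (h.trans (const_app_zero x _))
    exact (NatTrans.naturality_apply sq.lift (SimplexCategory.δ j).op
      (stdSimplex.objEquiv.symm (𝟙 _))).symm

/-- A property of vertices which is constant along edges defines a map to a constant simplicial
set. -/
def toConstantOfEdges {L : SSet.{u}} (P : L _⦋0⦌ → Prop)
    (hP : ∀ e : L _⦋1⦌, P (L.map (SimplexCategory.δ 1).op e) ↔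
      P (L.map (SimplexCategory.δ 0).op e)) : L ⟶ constant (ULift.{u} Prop) :=
  toConstant (fun n y ↦ ⟨P (L.map (SimplexCategory.const ⦋0⦌ n.unop 0).op y)⟩) (fun {n m} θ y ↦ by
    refine congrArg ULift.up (propext ?_)
    -- Restriction along `θ` replaces the first vertex of `y` by its vertex `θ(0)`; this edge of `y`
    -- joins the two.
    let e : L _⦋1⦌ := L.map (SimplexCategory.mkOfLe 0 (θ.unop.toOrderHom 0) (Fin.zero_le _)).op y
    have h₀ : L.map (SimplexCategory.const ⦋0⦌ n.unop 0).op y =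
        L.map (SimplexCategory.δ 1).op e := by
      rw [← Functor.map_comp_apply, ← op_comp]
      congr 4
      ext i
      fin_cases i
      rfl
    have h₁ : L.map (SimplexCategory.const ⦋0⦌ m.unop 0).op (L.map θ y) =
        L.map (SimplexCategory.δ 0).op e := by
      rw [← Functor.map_comp_apply, ← Functor.map_comp_apply, ← op_comp]
      congr 3
      apply Quiver.Hom.unop_inj
      ext i
      fin_cases i
      rfl
    rw [h₀, h₁]
    exact (hP e).symm)

lemma toConstantOfEdges_app_zero {L : SSet.{u}} (P : L _⦋0⦌ → Prop)
    (hP : ∀ e : L _⦋1⦌, P (L.map (SimplexCategory.δ 1).op e) ↔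
      P (L.map (SimplexCategory.δ 0).op e)) (y : L _⦋0⦌) :
    ((toConstantOfEdges P hP).app _ y : ULift.{u} Prop) = ⟨P y⟩ :=
  congrArg (fun y ↦ ULift.up (P y)) (map_const_zero L y)

/-- A Kan fibration which is a weak equivalence is surjective on vertices. -/
lemma IsKanFibration.surjective_app_zero {K L : SSet.{u}} {f : K ⟶ L} (hf : IsKanFibration f)
    (hf' : IsWeakEquivalence f) : Function.Surjective (f.app (op ⦋0⦌)) := by
  -- By edge lifting the image on vertices is a union of components. Its indicator map is `True`
  -- after restriction to `K`, hence `True` on `L`.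
  have edge : ∀ e : L _⦋1⦌, (∃ x, f.app _ x = L.map (SimplexCategory.δ 1).op e) ↔
      ∃ x, f.app _ x = L.map (SimplexCategory.δ 0).op e := fun e ↦ by
    constructor
    · rintro ⟨x, hx⟩
      obtain ⟨e', rfl, -⟩ := hf.exists_edge 0 1 (by simp) e x hx
      exact ⟨_, NatTrans.naturality_apply f _ e'⟩
    · rintro ⟨x, hx⟩
      obtain ⟨e', rfl, -⟩ := hf.exists_edge 1 0 (by simp) e x hx
      exact ⟨_, NatTrans.naturality_apply f _ e'⟩
  let χ := toConstantOfEdges (fun y : L _⦋0⦌ ↦ ∃ x, f.app (op ⦋0⦌) x = y) edge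
  have h : χ = toConstant (fun _ _ ↦ ULift.up True) (fun _ _ ↦ rfl) := by
    refine hf'.hom_constant_ext ?_
    ext n x
    refine congrArg ULift.up (eq_true ?_)
    exact ⟨_, NatTrans.naturality_apply f _ x⟩
  intro y
  have h' := of_eq_true (congrArg ULift.down (ConcreteCategory.congr_hom (congr_app h _) y))
  obtain ⟨x, hx⟩ := h'
  exact ⟨x, hx.trans (map_const_zero L y)⟩

end SSet

end

/-! ### Retracts, cofibrancy of orbits and contractible diagrams -/

section

open Opposite Simplicial

lemma SSet.IsContractible.of_iso {K L : SSet.{u}} (hK : K.IsContractible) (e : K ≅ L) :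
    L.IsContractible :=
  SSet.IsWeakEquivalence.of_retract hK e.inv e.hom (𝟙 _) (𝟙 _) e.inv_hom_id (Category.id_comp _)
    (Subsingleton.elim _ _) (Subsingleton.elim _ _)

namespace SpaceDiagram

section Generic

variable {D : Type u} [SmallCategory D] {𝒮 : Type (u + 1)} [LargeCategory.{u} 𝒮]
  [SpaceCategory.{u} 𝒮]

/-- The simplicial set of maps `Δ^n × X ⟶ Y` where `Y` is a diagram in the ambient category. -/
def mapComplex (X : D ⥤ 𝒮) (Y : D ⥤ SpaceCategory.Amb 𝒮) : SSet.{u} where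
  obj n := X ⋙ SpaceCategory.simplexProd.obj n.unop ⟶ Y
  map θ := ↾fun φ ↦ Functor.whiskerLeft X (SpaceCategory.simplexProd.map θ.unop) ≫ φ
  map_id n := by
    ext φ
    simp
  map_comp θ θ' := by
    ext φ
    simp

/-- Isomorphic targets give isomorphic mapping complexes. -/
def mapComplexIso (X : D ⥤ 𝒮) {Y Y' : D ⥤ SpaceCategory.Amb 𝒮} (e : Y ≅ Y') :
    mapComplex X Y ≅ mapComplex X Y' where
  hom := { app := fun n ↦ ↾fun φ ↦ φ ≫ e.hom
           naturality := fun n m θ ↦ by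
             ext φ
             exact Category.assoc _ _ _ }
  inv := { app := fun n ↦ ↾fun φ ↦ φ ≫ e.inv
           naturality := fun n m θ ↦ by
             ext φ
             exact Category.assoc _ _ _ }
  hom_inv_id := by
    ext n φ
    exact (Category.assoc _ _ _).trans ((congrArg (φ ≫ ·) e.hom_inv_id).trans (Category.comp_id _))
  inv_hom_id := by
    ext n φ
    exact (Category.assoc _ _ _).trans ((congrArg (φ ≫ ·) e.inv_hom_id).trans (Category.comp_id _))

/-- The map `hom(A', X) ⟶ hom(A, X)` induced by `r : A ⟶ A'`. -/
def funComplexPrecomp {A A' : D ⥤ 𝒮} (r : A ⟶ A') (X : D ⥤ 𝒮) :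
    funComplex A' X ⟶ funComplex A X where
  app n := ↾fun φ ↦ Functor.whiskerRight r (SpaceCategory.simplexProd.obj n.unop) ≫ φ
  naturality n m θ := by
    ext φ
    refine NatTrans.ext (funext fun d ↦ ?_)
    exact NatTrans.naturality_assoc (SpaceCategory.simplexProd.map θ.unop) (r.app d) (φ.app d)

lemma funComplexPrecomp_comp_of_eq_id {A A' : D ⥤ 𝒮} (s : A ⟶ A') (r : A' ⟶ A) (h : s ≫ r = 𝟙 A)
    (X : D ⥤ 𝒮) : funComplexPrecomp r X ≫ funComplexPrecomp s X = 𝟙 _ := by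
  ext n φ
  refine (Category.assoc _ _ _).symm.trans ?_
  refine (congrArg (· ≫ φ) (Functor.whiskerRight_comp s r _).symm).trans ?_
  rw [h, Functor.whiskerRight_id']
  exact Category.id_comp _

lemma funComplexMap_comp_funComplexPrecomp {A A' : D ⥤ 𝒮} (r : A ⟶ A') {X Y : D ⥤ 𝒮} (f : X ⟶ Y) :
    funComplexMap A' f ≫ funComplexPrecomp r Y = funComplexPrecomp r X ≫ funComplexMap A f := by
  ext n φ
  exact (Category.assoc _ _ _).symm

/-- Function complexes are functorial in the source, so `hom(T, g')` is a retract of `hom(b, g')`, a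
weak equivalence by definition of a colocal equivalence. -/
lemma isColocal_of_retract {B : Set (D ⥤ 𝒮)} {T b : D ⥤ 𝒮} (hT : IsCofibrant T) (hb : b ∈ B)
    (s : T ⟶ b) (r : b ⟶ T) (h : s ≫ r = 𝟙 T) : IsColocal B T :=
  ⟨hT, fun _ _ _ hg X' Y' g' hg' ↦ (hg g' hg' b hb).of_retract
    (funComplexPrecomp r X') (funComplexPrecomp s X')
    (funComplexPrecomp r Y') (funComplexPrecomp s Y')
    (funComplexPrecomp_comp_of_eq_id s r h X') (funComplexPrecomp_comp_of_eq_id s r h Y')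
    (funComplexMap_comp_funComplexPrecomp r g') (funComplexMap_comp_funComplexPrecomp s g')⟩

variable (𝒮) in
/-- Basic properties of a category of spaces. -/
structure SpaceProperties where
  /-- The inclusion in the ambient category is fully faithful. -/
  fullyFaithful : (SpaceCategory.incl (𝒮 := 𝒮)).FullyFaithful
  /-- `Δ^0 × X` is `X`. -/
  zeroIso : SpaceCategory.simplexProd.obj ⦋0⦌ ≅ SpaceCategory.incl (𝒮 := 𝒮)
  /-- The empty space. -/
  empty : 𝒮
  /-- The empty space is initial. -/
  isInitialEmpty : IsInitial empty
  /-- The point. -/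
  point : 𝒮
  /-- The point is terminal. -/
  isTerminalPoint : IsTerminal point
  /-- The point is terminal in the ambient category. -/
  isTerminalInclPoint : IsTerminal (SpaceCategory.incl.obj point)

namespace SpaceProperties

variable (h : SpaceProperties 𝒮)
include h

/-- The vertices of `hom(X, Y)` are the maps `X ⟶ Y`. -/
def vertexEquiv (X Y : D ⥤ 𝒮) : (X ⟶ Y) ≃ (funComplex X Y) _⦋0⦌ where
  toFun f := Functor.whiskerLeft X h.zeroIso.hom ≫ Functor.whiskerRight f SpaceCategory.incl
  invFun φ :=
    { app := fun d ↦ h.fullyFaithful.preimage (h.zeroIso.inv.app (X.obj d) ≫ φ.app d)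
      naturality := fun d d' f ↦ by
        apply h.fullyFaithful.map_injective
        have h₁ := h.zeroIso.inv.naturality_assoc (X.map f) (φ.app d')
        have h₂ := φ.naturality f
        simp only [Functor.map_comp, Functor.FullyFaithful.map_preimage, Category.assoc]
        rw [h₁]
        exact congrArg (h.zeroIso.inv.app (X.obj d) ≫ ·) h₂ }
  left_inv f := by
    ext d
    apply h.fullyFaithful.map_injective
    rw [Functor.FullyFaithful.map_preimage]
    exact h.zeroIso.inv_hom_id_app_assoc (X.obj d) _
  right_inv φ := by
    refine NatTrans.ext (funext fun d ↦ ?_)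
    refine (congrArg (h.zeroIso.hom.app (X.obj d) ≫ ·)
      (h.fullyFaithful.map_preimage _)).trans ?_
    exact h.zeroIso.hom_inv_id_app_assoc (X.obj d) _

lemma vertexEquiv_comp {X Y Y' : D ⥤ 𝒮} (f : X ⟶ Y) (g : Y ⟶ Y') :
    h.vertexEquiv X Y' (f ≫ g) = (funComplexMap X g).app _ (h.vertexEquiv X Y f) := by
  refine NatTrans.ext (funext fun d ↦ ?_)
  refine (congrArg (h.zeroIso.hom.app (X.obj d) ≫ ·) (Functor.map_comp _ _ _)).trans ?_
  exact (Category.assoc _ _ _).symm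

/-- For an acyclic fibration `p`, the map `hom(T, p)` is an acyclic Kan fibration by definition,
hence surjective on vertices; a vertex over `v` is the required lift. -/
lemma isCofibrant_of_isOrbit {T : D ⥤ 𝒮} (hT : IsOrbit T) : IsCofibrant T := by
  let I : D ⥤ 𝒮 := (Functor.const D).obj h.empty
  let hI : IsInitial I := IsInitial.ofUniqueHom
    (fun X ↦ { app := fun d ↦ h.isInitialEmpty.to _
               naturality := fun _ _ _ ↦ h.isInitialEmpty.hom_ext _ _ })
    (fun X m ↦ by ext d; exact h.isInitialEmpty.hom_ext _ _)
  refine ⟨I, hI, fun E F p hp hp' ↦ ⟨fun {u v} sq ↦ ?_⟩⟩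
  obtain ⟨x, hx⟩ := (hp T hT).surjective_app_zero (hp' T hT) (h.vertexEquiv _ _ v)
  refine ⟨⟨{ l := (h.vertexEquiv _ _).symm x
             fac_left := hI.hom_ext _ _
             fac_right := ?_ }⟩⟩
  apply (h.vertexEquiv _ _).injective
  rw [vertexEquiv_comp, Equiv.apply_symm_apply, hx]

/-- The terminal diagram. -/
def isTerminalConst : IsTerminal ((Functor.const D).obj h.point) :=
  IsTerminal.ofUniqueHom
    (fun X ↦ { app := fun d ↦ h.isTerminalPoint.from _
               naturality := fun _ _ _ ↦ h.isTerminalPoint.hom_ext _ _ })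
    (fun X m ↦ by ext d; exact h.isTerminalPoint.hom_ext _ _)

/-- The values of the terminal diagram are terminal in the ambient category. -/
def isTerminalIncl {P : D ⥤ 𝒮} (hP : IsTerminal P) (d : D) :
    IsTerminal (SpaceCategory.incl.obj (P.obj d)) :=
  h.isTerminalInclPoint.ofIso
    (SpaceCategory.incl.mapIso ((h.isTerminalConst.uniqueUpToIso hP).app d))

lemma subsingleton_funComplex {P : D ⥤ 𝒮} (hP : IsTerminal P) (X : D ⥤ 𝒮)
    (n : SimplexCategoryᵒᵖ) : Subsingleton ((funComplex X P).obj n) :=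
  ⟨fun φ ψ ↦ NatTrans.ext (funext fun d ↦ (h.isTerminalIncl hP d).hom_ext (φ.app d) (ψ.app d))⟩

/-- If `Z` is a diagram all of whose function complexes have horn fillings, and whose function
complexes from the members of a set detecting contractibility are contractible, then its function
complexes from orbits are nonempty and connected. -/
lemma exists_isWeakEquivalence {B : Set (D ⥤ 𝒮)} (hB : DetectsContractibility B) (Z : D ⥤ 𝒮)
    (hZ : ∀ T, IsOrbit T → (funComplex T Z).HasHornFilling)
    (hZB : ∀ b ∈ B, (funComplex b Z).IsContractible) {U : D ⥤ 𝒮} (hU : IsOrbit U) :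
    Nonempty (U ⟶ Z) ∧ ∀ {Q : Type u} (a : funComplex U Z ⟶ SSet.constant Q)
      (x y : (funComplex U Z) _⦋0⦌), (a.app _ x : Q) = a.app _ y := by
  -- Function complexes into the terminal diagram have at most one simplex in each degree, so horn
  -- filling for `Z` gives lifting against the map to it.
  have hZ' : IsFibrant Z := ⟨_, h.isTerminalConst, fun T hT ↦
    (hZ T hT).isKanFibration (h.subsingleton_funComplex h.isTerminalConst T) _⟩
  obtain ⟨P, hP, hw⟩ := (hB Z hZ').2 hZB
  refine ⟨?_, fun a x y ↦ (hw U hU).app_constant_eq (h.subsingleton_funComplex hP _ _) a x y⟩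
  obtain ⟨x⟩ := (hw U hU).nonempty_vertex (h.vertexEquiv U P (hP.from U))
  exact ⟨(h.vertexEquiv U Z).symm x⟩

end SpaceProperties

end Generic

end SpaceDiagram

end

section

open Opposite Simplicial

namespace SpaceDiagram

/-! ### Diagrams of sets -/

variable {D : Type u} [SmallCategory D]

/-- A diagram of sets is connected if every cocone under it is constant. -/
def IsConnectedDiagram (t : D ⥤ Type u) : Prop :=
  ∀ ⦃Q : Type u⦄ (g : ∀ d, t.obj d → Q), (∀ ⦃d d'⦄ (f : d ⟶ d') x, g d' (t.map f x) = g d x) →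
    ∀ d d' x x', g d x = g d' x'

/-- A point of a diagram of sets: a compatible family of elements. -/
structure PointOf (t : D ⥤ Type u) where
  /-- The elements. -/
  pt (d : D) : t.obj d
  map_pt ⦃d d' : D⦄ (f : d ⟶ d') : t.map f (pt d) = pt d'

/-! ### Wedges of a pointed diagram of sets -/

section Wedge

open scoped Classical

variable {t : D ⥤ Type u} (p : PointOf t) (I : Type u)

/-- The elements of the wedge of copies of a pointed set indexed by `I`, as families of elements with
at most one coordinate which is not the base point. -/
@[ext]
structure Wedge (d : D) : Type u where
  /-- The coordinates. -/
  coord : I → t.obj d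
  subsingleton : { i | coord i ≠ p.pt d }.Subsingleton

/-- The wedge of copies of a pointed diagram of sets indexed by `I`. -/
def wedge : D ⥤ Type u where
  obj d := Wedge p I d
  map {d d'} φ := ↾fun f ↦ ⟨fun i ↦ t.map φ (f.coord i), f.subsingleton.anti fun i hi hi' ↦ hi
    ((congrArg (t.map φ) hi').trans (p.map_pt φ))⟩
  map_id d := by
    ext f i
    exact Functor.map_id_apply t _ (f.coord i)
  map_comp φ ψ := by
    ext f i
    exact Functor.map_comp_apply t φ ψ (f.coord i)

variable {p I}

/-- The support of an element of the wedge. -/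
def Wedge.supp {d : D} (f : Wedge p I d) : Set I := { i | f.coord i ≠ p.pt d }

lemma Wedge.supp_map {d d' : D} (φ : d ⟶ d') (f : Wedge p I d) :
    supp (p := p) ((wedge p I).map φ f) ⊆ supp f := fun _ hi hi' ↦ hi
  ((congrArg (t.map φ) hi').trans (p.map_pt φ))

variable (p I) in
/-- The base point of the wedge. -/
def wedgeBase : PointOf (wedge p I) where
  pt d := ⟨fun _ ↦ p.pt d, fun _ hi ↦ (hi rfl).elim⟩
  map_pt _ _ φ := Wedge.ext (funext fun _ ↦ p.map_pt φ)

lemma supp_wedgeBase (d : D) : Wedge.supp (p := p) ((wedgeBase p I).pt d) = ∅ :=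
  Set.eq_empty_of_forall_notMem fun _ hi ↦ hi rfl

variable (p) in
/-- The inclusion of a summand in the wedge. -/
noncomputable def wedgeIncl (i : I) (d : D) (x : t.obj d) : Wedge p I d where
  coord j := if j = i then x else p.pt d
  subsingleton j hj k hk := by
    have key : ∀ j, (if j = i then x else p.pt d) ≠ p.pt d → j = i := fun j hj ↦ by
      by_contra h
      exact hj (if_neg h)
    rw [key j hj, key k hk]

lemma wedgeIncl_coord_self (i : I) (d : D) (x : t.obj d) : (wedgeIncl p i d x).coord i = x :=
  if_pos rfl

lemma map_wedgeIncl (i : I) {d d' : D} (φ : d ⟶ d') (x : t.obj d) :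
    (wedge p I).map φ (wedgeIncl p i d x) = wedgeIncl p i d' (t.map φ x) := by
  refine Wedge.ext (funext fun j ↦ ?_)
  change t.map φ (if j = i then x else p.pt d) = if j = i then t.map φ x else p.pt d'
  split_ifs
  · rfl
  · exact p.map_pt φ

lemma wedgeIncl_pt (i : I) (d : D) : wedgeIncl p i d (p.pt d) = (wedgeBase p I).pt d :=
  Wedge.ext (funext fun _ ↦ ite_self _)

lemma Wedge.eq_wedgeIncl {d : D} (f : Wedge p I d) (i : I) (hi : i ∈ supp f) :
    f = wedgeIncl p i d (f.coord i) := by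
  refine Wedge.ext (funext fun j ↦ ?_)
  change f.coord j = if j = i then f.coord i else p.pt d
  split_ifs with h
  · rw [h]
  · by_contra h'
    exact h (f.subsingleton h' hi)

lemma Wedge.eq_wedgeBase {d : D} (f : Wedge p I d) (hf : supp f = ∅) :
    f = (wedgeBase p I).pt d := by
  refine Wedge.ext (funext fun j ↦ ?_)
  by_contra h'
  exact Set.eq_empty_iff_forall_notMem.1 hf j h'

/-- Every summand is connected and all summands share the base point. -/
lemma isConnectedDiagram_wedge [Nonempty I] (ht : IsConnectedDiagram t) :
    IsConnectedDiagram (wedge p I) := by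
  intro Q g hg
  have hincl : ∀ i d d' x x', g d (wedgeIncl p i d x) = g d' (wedgeIncl p i d' x') := fun i ↦
    ht (fun d x ↦ g d (wedgeIncl p i d x)) fun d d' f x ↦
      (congrArg (g d') (map_wedgeIncl i f x)).symm.trans (hg f _)
  obtain ⟨i₀⟩ := ‹Nonempty I›
  have hbase : ∀ d d', g d ((wedgeBase p I).pt d) = g d' ((wedgeBase p I).pt d') := fun d d' ↦ by
    rw [← wedgeIncl_pt i₀, ← wedgeIncl_pt i₀]
    exact hincl _ _ _ _ _
  have key : ∀ d (f : Wedge p I d), g d f = g d ((wedgeBase p I).pt d) := fun d f ↦ by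
    obtain h | ⟨i, hi⟩ := f.supp.eq_empty_or_nonempty
    · rw [f.eq_wedgeBase h]
    · rw [f.eq_wedgeIncl i hi, ← wedgeIncl_pt i]
      exact hincl _ _ _ _ _
  intro d d' x x'
  rw [key d x, key d' x', hbase d d']

/-- If `t` is not trivial, the supports of elements of the wedge are not bounded by a proper
subset. -/
lemma Wedge.exists_not_supp_subset {d : D} {x : t.obj d} (hx : x ≠ p.pt d) {A : Set I}
    (hA : A ≠ Set.univ) : ∃ f : Wedge p I d, ¬ supp f ⊆ A := by
  obtain ⟨i, hi⟩ := (Set.ne_univ_iff_exists_notMem A).1 hA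
  refine ⟨wedgeIncl p i d x, fun h ↦ hi (h ?_)⟩
  change (wedgeIncl p i d x).coord i ≠ _
  rwa [wedgeIncl_coord_self]

end Wedge

/-! ### Labels: small subsets of a large index set -/

section Labels

variable (c : Cardinal.{u})

/-- An index set of cardinality greater than `c`. -/
def BigIndex : Type u := Set c.out

instance : Nonempty (BigIndex c) := inferInstanceAs (Nonempty (Set c.out))

/-- The subsets of `BigIndex c` of cardinality at most `c`. -/
def Label : Type u := { A : Set (BigIndex c) // Cardinal.mk A ≤ c }

instance : Inhabited (Label c) := ⟨⟨∅, by simp⟩⟩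

variable {c}

/-- Cantor's theorem: the index set is a power set of a set of cardinality `c`. -/
lemma Label.ne_univ (A : Label c) : A.1 ≠ Set.univ := fun h ↦ by
  have h₁ := A.2
  rw [h, Cardinal.mk_univ] at h₁
  have h₂ : c < Cardinal.mk (BigIndex c) := by
    have := Cardinal.cantor c
    rwa [← Cardinal.mk_out c, ← Cardinal.mk_set, Cardinal.mk_out c] at this
  exact absurd h₁ (not_le.2 h₂)

/-- The union of two labels. -/
def Label.union (hc : Cardinal.aleph0 ≤ c) (A A' : Label c) : Label c :=
  ⟨A.1 ∪ A'.1, (Cardinal.mk_union_le _ _).trans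
    ((add_le_add A.2 A'.2).trans (Cardinal.add_eq_self hc).le)⟩

/-- A union of at most `c` sets, each with at most one element, has cardinality at most `c`. This is
where the small support of wedge elements pays off. -/
lemma Label.exists_bound {X : Type u} (hX : Cardinal.mk X ≤ c) (S : X → Set (BigIndex c))
    (hS : ∀ x, (S x).Subsingleton) : ∃ A : Label c, ∀ x, S x ⊆ A.1 := by
  refine ⟨⟨⋃ x, S x, ?_⟩, fun x ↦ Set.subset_iUnion S x⟩
  refine (Cardinal.mk_iUnion_le_sum_mk (f := S)).trans ?_
  refine (Cardinal.sum_le_sum _ (fun _ ↦ 1) fun x ↦ ?_).trans ?_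
  · exact Cardinal.mk_le_one_iff_set_subsingleton.2 (hS x)
  · simpa using hX

/-- There is an infinite cardinal bounding a small family of types. -/
lemma exists_cardinal {E : Type*} [Small.{u} E] (F : E → Type u) :
    ∃ c : Cardinal.{u}, Cardinal.aleph0 ≤ c ∧ ∀ e, Cardinal.mk (F e) ≤ c := by
  let s : Cardinal.{u} := Cardinal.sum fun e : Shrink.{u} E ↦ Cardinal.mk (F ((equivShrink E).symm e))
  refine ⟨max Cardinal.aleph0 s, le_max_left _ _, fun e ↦ le_max_of_le_right ?_⟩
  have := Cardinal.le_sum (fun e : Shrink.{u} E ↦ Cardinal.mk (F ((equivShrink E).symm e)))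
    (equivShrink E e)
  simpa using this

end Labels

end SpaceDiagram

end

section

open Opposite Simplicial

namespace SpaceDiagram

/-! ### Simplicial sets of labelled graphs -/

variable {D : Type u} [SmallCategory D]

/-- Equivalence relations on a diagram of sets indexed by labels, such that the composition of two
of them is contained in a third one. -/
structure LabelledRel (W : D ⥤ Type u) (Λ : Type u) where
  /-- The relations. -/
  rel (l : Λ) (d : D) : W.obj d → W.obj d → Prop
  refl (l : Λ) (d : D) (w : W.obj d) : rel l d w w
  symm {l : Λ} {d : D} {w w' : W.obj d} : rel l d w w' → rel l d w' w
  map {l : Λ} {d d' : D} (f : d ⟶ d') {w w' : W.obj d} :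
    rel l d w w' → rel l d' (W.map f w) (W.map f w')
  /-- A label for the composition of two relations. -/
  join : Λ → Λ → Λ
  trans {l l' : Λ} {d : D} {w w' w'' : W.obj d} :
    rel l d w w' → rel l' d w' w'' → rel (join l l') d w w''

namespace LabelledRel

variable {W : D ⥤ Type u} {Λ : Type u} (R : LabelledRel W Λ)

/-- The simplices of the simplicial set of vertices `w` and labelled edges. -/
@[ext]
structure Simplex (d : D) (n : SimplexCategory) : Type u where
  /-- The vertices. -/
  vert : (⦋0⦌ ⟶ n) → W.obj d
  /-- The labels of the edges. -/
  label : (⦋1⦌ ⟶ n) → Λ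
  rel (e : ⦋1⦌ ⟶ n) :
    R.rel (label e) d (vert (SimplexCategory.δ 1 ≫ e)) (vert (SimplexCategory.δ 0 ≫ e))

/-- The simplicial set whose `n`-simplices are families of vertices indexed by `[n]` with a label
for each edge. -/
def complex (d : D) : SSet.{u} where
  obj n := R.Simplex d n.unop
  map θ := ↾fun s ↦
    { vert v := s.vert (v ≫ θ.unop)
      label e := s.label (e ≫ θ.unop)
      rel e := by simpa using s.rel (e ≫ θ.unop) }

/-- The diagram of simplicial sets of labelled graphs. -/
def diagram : D ⥤ SSet.{u} where
  obj d := R.complex d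
  map {d d'} f :=
    { app n := ↾fun s ↦
        { vert v := W.map f (s.vert v)
          label e := s.label e
          rel e := R.map f (s.rel e) } }
  map_id d := by
    ext n s
    refine Simplex.ext (funext fun v ↦ ?_) rfl
    exact Functor.map_id_apply W d (s.vert v)
  map_comp f g := by
    ext n s
    refine Simplex.ext (funext fun v ↦ ?_) rfl
    exact Functor.map_comp_apply W f g (s.vert v)

/-- The data corresponding to a map from `X` to the complex of maps from `T` to the diagram of
labelled graphs. -/
structure Family (T : D ⥤ SSet.{u}) (X : SSet.{u}) where
  /-- The vertices. -/
  vert (d : D) : X _⦋0⦌ → (T.obj d) _⦋0⦌ → W.obj d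
  vert_map {d d' : D} (f : d ⟶ d') (x : X _⦋0⦌) (t : (T.obj d) _⦋0⦌) :
    vert d' x ((T.map f).app _ t) = W.map f (vert d x t)
  /-- The labels of the edges. -/
  label (d : D) : X _⦋1⦌ → (T.obj d) _⦋1⦌ → Λ
  label_map {d d' : D} (f : d ⟶ d') (x : X _⦋1⦌) (t : (T.obj d) _⦋1⦌) :
    label d' x ((T.map f).app _ t) = label d x t
  rel (d : D) (x : X _⦋1⦌) (t : (T.obj d) _⦋1⦌) : R.rel (label d x t) d
    (vert d (X.map (SimplexCategory.δ 1).op x) ((T.obj d).map (SimplexCategory.δ 1).op t))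
    (vert d (X.map (SimplexCategory.δ 0).op x) ((T.obj d).map (SimplexCategory.δ 0).op t))

variable {R} {T : D ⥤ SSet.{u}} {X : SSet.{u}}

/-- A simplex of `Δ^n × T`. -/
def prodMk {n : SimplexCategory} {m : SimplexCategoryᵒᵖ} (σ : m.unop ⟶ n) {d : D}
    (t : (T.obj d).obj m) : (SSet.stdSimplex.obj n ⊗ T.obj d : SSet.{u}).obj m :=
  (SSet.stdSimplex.objEquiv.symm σ, t)

/-- The map associated to a family. -/
def Family.toMap (F : Family R T X) : X ⟶ mapComplex T R.diagram where
  app n := ↾fun x ↦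
    { app d :=
        { app m := ↾fun y ↦
            { vert v := F.vert d (X.map (v ≫ SSet.stdSimplex.objEquiv y.1).op x)
                ((T.obj d).map v.op y.2)
              label e := F.label d (X.map (e ≫ SSet.stdSimplex.objEquiv y.1).op x)
                ((T.obj d).map e.op y.2)
              rel e := by
                have h := F.rel d (X.map (e ≫ SSet.stdSimplex.objEquiv y.1).op x)
                  ((T.obj d).map e.op y.2)
                simpa only [← Functor.map_comp_apply, ← op_comp, Category.assoc] using h }
          naturality m m' θ := by
            ext y
            refine Simplex.ext (funext fun v ↦ ?_) (funext fun v ↦ ?_)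
            · exact congrArg₂ (F.vert d)
                (congrArg (fun u : ⦋0⦌ ⟶ n.unop ↦ X.map u.op x)
                  (Category.assoc v θ.unop (SSet.stdSimplex.objEquiv y.1)).symm)
                (Functor.map_comp_apply (T.obj d) θ v.op y.2).symm
            · exact congrArg₂ (F.label d)
                (congrArg (fun u : ⦋1⦌ ⟶ n.unop ↦ X.map u.op x)
                  (Category.assoc v θ.unop (SSet.stdSimplex.objEquiv y.1)).symm)
                (Functor.map_comp_apply (T.obj d) θ v.op y.2).symm }
      naturality d d' f := by
        refine NatTrans.ext (funext fun m ↦ ?_)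
        ext y
        refine Simplex.ext (funext fun v ↦ ?_) (funext fun v ↦ ?_)
        · refine Eq.trans ?_ (F.vert_map f _ _)
          exact congrArg (F.vert d' _) (NatTrans.naturality_apply (T.map f) v.op y.2).symm
        · refine Eq.trans ?_ (F.label_map f _ _)
          exact congrArg (F.label d' _) (NatTrans.naturality_apply (T.map f) v.op y.2).symm }
  naturality n n' θ := by
    ext x
    refine NatTrans.ext (funext fun d ↦ NatTrans.ext (funext fun m ↦ ?_))
    ext y
    refine Simplex.ext (funext fun v ↦ ?_) (funext fun v ↦ ?_)
    · refine congrArg (F.vert d · _) ?_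
      exact (Functor.map_comp_apply X _ _ _).symm
    · refine congrArg (F.label d · _) ?_
      exact (Functor.map_comp_apply X _ _ _).symm

/-- The map of simplicial sets associated to a simplex of the complex of maps. -/
def evalHom (a : X ⟶ mapComplex T R.diagram) (n : SimplexCategory) (d : D) (x : X.obj (op n)) :
    SSet.stdSimplex.obj n ⊗ T.obj d ⟶ R.complex d :=
  (a.app (op n) x).app d

/-- The simplex of labelled graph associated to simplices of `X` and `T`. -/
def eval (a : X ⟶ mapComplex T R.diagram) (n : SimplexCategory) (d : D) (x : X.obj (op n))
    (m : SimplexCategoryᵒᵖ) (σ : m.unop ⟶ n) (t : (T.obj d).obj m) : R.Simplex d m.unop :=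
  (evalHom a n d x).app m (prodMk σ t)

lemma eval_map (a : X ⟶ mapComplex T R.diagram) {n n' : SimplexCategory} (θ : n' ⟶ n) (d : D)
    (x : X.obj (op n)) (m : SimplexCategoryᵒᵖ) (σ : m.unop ⟶ n') (t : (T.obj d).obj m) :
    eval a n' d (X.map θ.op x) m σ t = eval a n d x m (σ ≫ θ) t := by
  have h := ConcreteCategory.congr_hom (a.naturality θ.op) x
  exact congrArg (fun φ : T ⋙ SpaceCategory.simplexProd.obj n' ⟶ R.diagram ↦
    (show SSet.stdSimplex.obj n' ⊗ T.obj d ⟶ R.complex d from φ.app d).app m (prodMk σ t)) h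

lemma eval_precomp (a : X ⟶ mapComplex T R.diagram) (n : SimplexCategory) (d : D) (x : X.obj (op n))
    {m m' : SimplexCategoryᵒᵖ} (θ : m ⟶ m') (σ : m.unop ⟶ n) (t : (T.obj d).obj m) :
    eval a n d x m' (θ.unop ≫ σ) ((T.obj d).map θ t) =
      (R.complex d).map θ (eval a n d x m σ t) :=
  NatTrans.naturality_apply (evalHom a n d x) θ (prodMk σ t)

lemma eval_diagram_map (a : X ⟶ mapComplex T R.diagram) (n : SimplexCategory) {d d' : D}
    (f : d ⟶ d') (x : X.obj (op n)) (m : SimplexCategoryᵒᵖ) (σ : m.unop ⟶ n) (t : (T.obj d).obj m) :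
    eval a n d' x m σ ((T.map f).app m t) = (R.diagram.map f).app m (eval a n d x m σ t) := by
  have h : (SSet.stdSimplex.obj n ◁ T.map f) ≫ evalHom a n d' x =
      evalHom a n d x ≫ R.diagram.map f := (a.app (op n) x).naturality f
  exact ConcreteCategory.congr_hom (congr_app h m) (prodMk σ t)

lemma eval_ext {a a' : X ⟶ mapComplex T R.diagram}
    (h : ∀ n d x m σ t, eval a n d x m σ t = eval a' n d x m σ t) : a = a' := by
  ext n x
  refine NatTrans.ext (funext fun d ↦ NatTrans.ext (funext fun m ↦ ?_))
  ext y
  exact h n.unop d x m (SSet.stdSimplex.objEquiv y.1) y.2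

/-- The family associated to a map. -/
def Family.ofMap (a : X ⟶ mapComplex T R.diagram) : Family R T X where
  vert d x t := (eval a ⦋0⦌ d x (op ⦋0⦌) (𝟙 _) t).vert (𝟙 _)
  vert_map f x t := by rw [eval_diagram_map]; rfl
  label d x t := (eval a ⦋1⦌ d x (op ⦋1⦌) (𝟙 _) t).label (𝟙 _)
  label_map f x t := by rw [eval_diagram_map]; rfl
  rel d x t := by
    have h := (eval a ⦋1⦌ d x (op ⦋1⦌) (𝟙 _) t).rel (𝟙 _)
    have key : ∀ i : Fin 2, (eval a ⦋0⦌ d (X.map (SimplexCategory.δ i).op x) (op ⦋0⦌) (𝟙 _)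
        ((T.obj d).map (SimplexCategory.δ i).op t)).vert (𝟙 _) =
        (eval a ⦋1⦌ d x (op ⦋1⦌) (𝟙 _) t).vert (SimplexCategory.δ i ≫ 𝟙 _) := fun i ↦ by
      have h₁ := eval_precomp a ⦋1⦌ d x (SimplexCategory.δ i).op (𝟙 _) t
      rw [eval_map, Category.id_comp]
      refine Eq.trans (congrArg (fun s : R.Simplex d ⦋0⦌ ↦ s.vert (𝟙 _)) (a₂ :=
        (R.complex d).map (SimplexCategory.δ i).op (eval a ⦋1⦌ d x (op ⦋1⦌) (𝟙 _) t)) ?_) (congrArg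
        (eval a ⦋1⦌ d x (op ⦋1⦌) (𝟙 _) t).vert
        ((Category.id_comp (SimplexCategory.δ i)).trans (Category.comp_id _).symm))
      refine Eq.trans (congrArg (fun u ↦ eval a ⦋1⦌ d x (op ⦋0⦌) u _) ?_) h₁
      exact (Category.comp_id _).symm
    rw [key 1, key 0]
    exact h

/-- A simplex of the labelled graph is just its vertices and edge labels, with no compatibility in
higher degrees. Naturality in both simplicial directions therefore reduces a map to its family;
`eval_label` treats the edges. -/
lemma eval_vert (a : X ⟶ mapComplex T R.diagram) (n : SimplexCategory) (d : D) (x : X.obj (op n))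
    (m : SimplexCategoryᵒᵖ) (σ : m.unop ⟶ n) (t : (T.obj d).obj m) (v : ⦋0⦌ ⟶ m.unop) :
    (eval a n d x m σ t).vert v =
      (Family.ofMap a).vert d (X.map (v ≫ σ).op x) ((T.obj d).map v.op t) := by
  have h₁ := congrArg (fun s : R.Simplex d ⦋0⦌ ↦ s.vert (𝟙 _)) (eval_precomp a n d x v.op σ t)
  have h₂ := congrArg (fun s : R.Simplex d ⦋0⦌ ↦ s.vert (𝟙 _))
    (eval_map a (v ≫ σ) d x (op ⦋0⦌) (𝟙 _) ((T.obj d).map v.op t))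
  refine Eq.trans ?_ h₂.symm
  refine Eq.trans (congrArg (eval a n d x m σ t).vert (Category.id_comp v).symm) ?_
  refine h₁.symm.trans ?_
  exact congrArg (fun u ↦ (eval a n d x (op ⦋0⦌) u ((T.obj d).map v.op t)).vert (𝟙 _))
    (Category.id_comp _).symm

lemma eval_label (a : X ⟶ mapComplex T R.diagram) (n : SimplexCategory) (d : D) (x : X.obj (op n))
    (m : SimplexCategoryᵒᵖ) (σ : m.unop ⟶ n) (t : (T.obj d).obj m) (v : ⦋1⦌ ⟶ m.unop) :
    (eval a n d x m σ t).label v =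
      (Family.ofMap a).label d (X.map (v ≫ σ).op x) ((T.obj d).map v.op t) := by
  have h₁ := congrArg (fun s : R.Simplex d ⦋1⦌ ↦ s.label (𝟙 _)) (eval_precomp a n d x v.op σ t)
  have h₂ := congrArg (fun s : R.Simplex d ⦋1⦌ ↦ s.label (𝟙 _))
    (eval_map a (v ≫ σ) d x (op ⦋1⦌) (𝟙 _) ((T.obj d).map v.op t))
  refine Eq.trans ?_ h₂.symm
  refine Eq.trans (congrArg (eval a n d x m σ t).label (Category.id_comp v).symm) ?_
  refine h₁.symm.trans ?_
  exact congrArg (fun u ↦ (eval a n d x (op ⦋1⦌) u ((T.obj d).map v.op t)).label (𝟙 _))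
    (Category.id_comp _).symm

/-- A map to the complex of maps is determined by its family. -/
lemma hom_ext_family {a a' : X ⟶ mapComplex T R.diagram}
    (hv : ∀ d x t, (Family.ofMap a).vert d x t = (Family.ofMap a').vert d x t)
    (hl : ∀ d x t, (Family.ofMap a).label d x t = (Family.ofMap a').label d x t) : a = a' :=
  eval_ext fun n d x m σ t ↦ Simplex.ext (funext fun v ↦ by rw [eval_vert, eval_vert, hv])
    (funext fun v ↦ by rw [eval_label, eval_label, hl])

lemma Family.ofMap_toMap_vert (F : Family R T X) (d : D) (x : X _⦋0⦌) (t : (T.obj d) _⦋0⦌) :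
    (Family.ofMap F.toMap).vert d x t = F.vert d x t := by
  change F.vert d (X.map (𝟙 _ ≫ 𝟙 _) x) ((T.obj d).map (𝟙 _) t) = _
  rw [Category.comp_id, Functor.map_id_apply, Functor.map_id_apply]

lemma Family.ofMap_toMap_label (F : Family R T X) (d : D) (x : X _⦋1⦌) (t : (T.obj d) _⦋1⦌) :
    (Family.ofMap F.toMap).label d x t = F.label d x t := by
  change F.label d (X.map (𝟙 _ ≫ 𝟙 _) x) ((T.obj d).map (𝟙 _) t) = _
  rw [Category.comp_id, Functor.map_id_apply, Functor.map_id_apply]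

lemma Family.ofMap_comp_vert {X' : SSet.{u}} (k : X' ⟶ X) (a : X ⟶ mapComplex T R.diagram) (d : D)
    (x : X' _⦋0⦌) (t : (T.obj d) _⦋0⦌) :
    (Family.ofMap (k ≫ a)).vert d x t = (Family.ofMap a).vert d (k.app _ x) t := rfl

lemma Family.ofMap_comp_label {X' : SSet.{u}} (k : X' ⟶ X) (a : X ⟶ mapComplex T R.diagram) (d : D)
    (x : X' _⦋1⦌) (t : (T.obj d) _⦋1⦌) :
    (Family.ofMap (k ≫ a)).label d x t = (Family.ofMap a).label d (k.app _ x) t := rfl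

end LabelledRel

end SpaceDiagram

end

/-! ### Horn filling and contraction for maps into labelled graphs -/

section

open Opposite Simplicial

/-- Every vertex of a horn is joined by an edge of the horn to the vertex which lies on all
faces. -/
lemma SSet.horn.exists_edge {n : ℕ} {i : Fin (n + 2)} (y : (Λ[n + 1, i] : SSet.{u}) _⦋0⦌) :
    ∃ e : (Λ[n + 1, i] : SSet.{u}) _⦋1⦌,
      ((Λ[n + 1, i] : SSet.{u}).map (SimplexCategory.δ 1).op e = y ∧
        (Λ[n + 1, i] : SSet.{u}).map (SimplexCategory.δ 0).op e = SSet.horn.vertex n i) ∨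
      ((Λ[n + 1, i] : SSet.{u}).map (SimplexCategory.δ 1).op e = SSet.horn.vertex n i ∧
        (Λ[n + 1, i] : SSet.{u}).map (SimplexCategory.δ 0).op e = y) := by
  obtain ⟨j, hj, hj'⟩ := (SSet.mem_horn_iff_notMem_range _ _).1 y.2
  have hy : (y.1 0 : Fin (n + 2)) ≠ j := fun h ↦ hj' ⟨0, h⟩
  obtain h | h := le_total (y.1 0 : Fin (n + 2)) i
  · refine ⟨⟨SSet.stdSimplex.edge _ _ _ h, ?_⟩, Or.inl ⟨?_, ?_⟩⟩
    · rw [SSet.mem_horn_iff_notMem_range]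
      refine ⟨j, hj, ?_⟩
      rintro ⟨k, hk⟩
      fin_cases k
      · exact hy hk
      · exact hj hk.symm
    · apply Subtype.ext
      ext k
      fin_cases k
      rfl
    · apply Subtype.ext
      ext k
      fin_cases k
      rfl
  · refine ⟨⟨SSet.stdSimplex.edge _ _ _ h, ?_⟩, Or.inr ⟨?_, ?_⟩⟩
    · rw [SSet.mem_horn_iff_notMem_range]
      refine ⟨j, hj, ?_⟩
      rintro ⟨k, hk⟩
      fin_cases k
      · exact hj hk.symm
      · exact hy hk
    · apply Subtype.ext
      ext k
      fin_cases k
      rfl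
    · apply Subtype.ext
      ext k
      fin_cases k
      rfl

namespace SpaceDiagram

variable {D : Type u} [SmallCategory D]

namespace LabelledRel

variable {W : D ⥤ Type u} {Λ : Type u} {R : LabelledRel W Λ} {T : D ⥤ SSet.{u}}

lemma Family.rel_degenerate {X : SSet.{u}} (F : Family R T X) (d : D) (x : X _⦋1⦌)
    (t : (T.obj d) _⦋0⦌) : R.rel (F.label d x ((T.obj d).map (SimplexCategory.σ 0).op t)) d
      (F.vert d (X.map (SimplexCategory.δ 1).op x) t)
      (F.vert d (X.map (SimplexCategory.δ 0).op x) t) := by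
  have h := F.rel d x ((T.obj d).map (SimplexCategory.σ 0).op t)
  have h₁ : (T.obj d).map (SimplexCategory.δ 1).op ((T.obj d).map (SimplexCategory.σ 0).op t) = t :=
    SSet.δ_comp_σ_succ_apply 0 t
  have h₀ : (T.obj d).map (SimplexCategory.δ 0).op ((T.obj d).map (SimplexCategory.σ 0).op t) = t :=
    SSet.δ_comp_σ_self_apply 0 t
  rwa [h₁, h₀] at h

section Horn

variable {n : ℕ} {i : Fin (n + 2)}

open Classical in
/-- The retraction of the vertices of a simplex to the vertices of a horn. -/
noncomputable def hornRetraction (i : Fin (n + 2)) (v : (Δ[n + 1] : SSet.{u}) _⦋0⦌) :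
    (Λ[n + 1, i] : SSet.{u}) _⦋0⦌ :=
  -- Only a horn in `Δ[1]` misses a vertex; in higher dimensions the second case never occurs.
  if hv : v ∈ (SSet.horn (n + 1) i).obj _ then ⟨v, hv⟩ else SSet.horn.vertex n i

lemma hornRetraction_of_mem (v : (Λ[n + 1, i] : SSet.{u}) _⦋0⦌) : hornRetraction i v.1 = v :=
  dif_pos v.2

/-- The label of the edge joining a vertex of a horn to the vertex which lies on all faces. -/
noncomputable def Family.link (F : Family R T (Λ[n + 1, i] : SSet.{u})) (d : D)
    (v : (Δ[n + 1] : SSet.{u}) _⦋0⦌) (t : (T.obj d) _⦋0⦌) : Λ :=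
  F.label d (SSet.horn.exists_edge (hornRetraction i v)).choose
    ((T.obj d).map (SimplexCategory.σ 0).op t)

lemma Family.rel_link (F : Family R T (Λ[n + 1, i] : SSet.{u})) (d : D)
    (v : (Δ[n + 1] : SSet.{u}) _⦋0⦌) (t : (T.obj d) _⦋0⦌) :
    R.rel (F.link d v t) d (F.vert d (hornRetraction i v) t)
      (F.vert d (SSet.horn.vertex n i) t) := by
  have h := F.rel_degenerate d (SSet.horn.exists_edge (hornRetraction i v)).choose t
  obtain ⟨h₁, h₀⟩ | ⟨h₁, h₀⟩ := (SSet.horn.exists_edge (hornRetraction i v)).choose_spec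
  · rwa [h₁, h₀] at h
  · rw [h₁, h₀] at h
    exact R.symm h

lemma Family.link_map (F : Family R T (Λ[n + 1, i] : SSet.{u})) {d d' : D} (f : d ⟶ d')
    (v : (Δ[n + 1] : SSet.{u}) _⦋0⦌) (t : (T.obj d) _⦋0⦌) :
    F.link d' v ((T.map f).app _ t) = F.link d v t := by
  refine Eq.trans ?_ (F.label_map f _ _)
  exact congrArg (F.label d' _) (NatTrans.naturality_apply (T.map f) (SimplexCategory.σ 0).op t).symm

open Classical in
/-- The extension of a family from a horn to a simplex. -/
noncomputable def Family.extend (F : Family R T (Λ[n + 1, i] : SSet.{u})) :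
    Family R T (Δ[n + 1] : SSet.{u}) where
  vert d v t := F.vert d (hornRetraction i v) t
  vert_map f v t := F.vert_map f _ t
  -- An edge outside the horn is replaced by a path inside it: link the source to the common vertex,
  -- follow `t` over the degenerate edge there, then link back to the target. The label is the join
  -- of the three labels.
  label d e t := if he : e ∈ (SSet.horn (n + 1) i).obj _ then F.label d ⟨e, he⟩ t else
    R.join (F.link d ((Δ[n + 1] : SSet.{u}).map (SimplexCategory.δ 1).op e)
      ((T.obj d).map (SimplexCategory.δ 1).op t))
    (R.join (F.label d ((Λ[n + 1, i] : SSet.{u}).map (SimplexCategory.σ 0).op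
      (SSet.horn.vertex n i)) t)
    (F.link d ((Δ[n + 1] : SSet.{u}).map (SimplexCategory.δ 0).op e)
      ((T.obj d).map (SimplexCategory.δ 0).op t)))
  label_map {d d'} f e t := by
    have h : ∀ j, (T.obj d').map (SimplexCategory.δ j).op ((T.map f).app _ t) =
        (T.map f).app _ ((T.obj d).map (SimplexCategory.δ j).op t) := fun j ↦
      (NatTrans.naturality_apply (T.map f) (SimplexCategory.δ j).op t).symm
    rw [h 0, h 1, F.link_map, F.link_map, F.label_map]
    split_ifs
    · exact F.label_map f _ t
    · rfl
  rel d e t := by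
    split_ifs with he
    · have h := F.rel d ⟨e, he⟩ t
      rw [← hornRetraction_of_mem ((Λ[n + 1, i] : SSet.{u}).map (SimplexCategory.δ 1).op ⟨e, he⟩),
        ← hornRetraction_of_mem ((Λ[n + 1, i] : SSet.{u}).map (SimplexCategory.δ 0).op ⟨e, he⟩)] at h
      exact h
    · refine R.trans (F.rel_link d _ _) (R.trans ?_ (R.symm (F.rel_link d _ _)))
      have h := F.rel d ((Λ[n + 1, i] : SSet.{u}).map (SimplexCategory.σ 0).op
        (SSet.horn.vertex n i)) t
      have h₁ : (Λ[n + 1, i] : SSet.{u}).map (SimplexCategory.δ 1).op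
          ((Λ[n + 1, i] : SSet.{u}).map (SimplexCategory.σ 0).op (SSet.horn.vertex n i)) =
          SSet.horn.vertex n i := SSet.δ_comp_σ_succ_apply 0 _
      have h₀ : (Λ[n + 1, i] : SSet.{u}).map (SimplexCategory.δ 0).op
          ((Λ[n + 1, i] : SSet.{u}).map (SimplexCategory.σ 0).op (SSet.horn.vertex n i)) =
          SSet.horn.vertex n i := SSet.δ_comp_σ_self_apply 0 _
      rwa [h₁, h₀] at h

/-- Maps into this complex are families on vertices and edges only, so it suffices to extend a
family from the horn to the vertices and edges of the simplex. -/
lemma hasHornFilling_mapComplex (T : D ⥤ SSet.{u}) (R : LabelledRel W Λ) :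
    (mapComplex T R.diagram).HasHornFilling := fun n i a ↦ by
  refine ⟨(Family.ofMap a).extend.toMap, hom_ext_family (fun d x t ↦ ?_) fun d x t ↦ ?_⟩
  · rw [Family.ofMap_comp_vert, Family.ofMap_toMap_vert]
    exact congrArg ((Family.ofMap a).vert d · t) (hornRetraction_of_mem x)
  · rw [Family.ofMap_comp_label, Family.ofMap_toMap_label]
    exact dif_pos x.2

end Horn

section Contraction

open Classical in
/-- The family contracting the complex of maps to a vertex. -/
noncomputable def contractionFamily (v : (mapComplex T R.diagram) _⦋0⦌)
    (β : (mapComplex T R.diagram) _⦋0⦌ → Λ)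
    (hβ : ∀ x d t t', R.rel (β x) d ((Family.ofMap (𝟙 (mapComplex T R.diagram))).vert d v t)
      ((Family.ofMap (𝟙 (mapComplex T R.diagram))).vert d x t')) :
    Family R T (mapComplex T R.diagram ⊗ Δ[1]) :=
  let F := Family.ofMap (𝟙 (mapComplex T R.diagram))
  { vert := fun d x t ↦ if x.2 0 = 0 then F.vert d v t else F.vert d x.1 t
    vert_map := fun f x t ↦ by
      split_ifs
      · exact F.vert_map f _ t
      · exact F.vert_map f _ t
    label := fun d x t ↦
      -- The three cases are the edges `00`, `01` and `11` of `Δ[1]`: stay at `v`, jump from `v` to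
      -- the endpoint of the edge with label `β`, or follow the edge. The jump label does not depend
      -- on `d` or `t`, as compatibility with `D` requires.
      if x.2 0 = 0 then
        if x.2 1 = 0 then F.label d ((mapComplex T R.diagram).map (SimplexCategory.σ 0).op v) t
        else β ((mapComplex T R.diagram).map (SimplexCategory.δ 0).op x.1)
      else F.label d x.1 t
    label_map := fun f x t ↦ by simp only [F.label_map]
    rel := fun d x t ↦ by
      change R.rel _ d (if x.2 0 = 0 then _ else _) (if x.2 1 = 0 then _ else _)
      split_ifs with h₀ h₁ h₁
      · have h := F.rel d ((mapComplex T R.diagram).map (SimplexCategory.σ 0).op v) t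
        have h₁ : (mapComplex T R.diagram).map (SimplexCategory.δ 1).op
            ((mapComplex T R.diagram).map (SimplexCategory.σ 0).op v) = v :=
          SSet.δ_comp_σ_succ_apply 0 v
        have h₀ : (mapComplex T R.diagram).map (SimplexCategory.δ 0).op
            ((mapComplex T R.diagram).map (SimplexCategory.σ 0).op v) = v :=
          SSet.δ_comp_σ_self_apply 0 v
        rwa [h₁, h₀] at h
      · exact hβ _ d _ _
      · have := SSet.stdSimplex.monotone_apply x.2 (Fin.zero_le 1)
        simp only [h₁] at this
        exact absurd (Fin.le_zero_iff.1 this) h₀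
      · exact F.rel d x.1 t }

variable (v : (mapComplex T R.diagram) _⦋0⦌) (β : (mapComplex T R.diagram) _⦋0⦌ → Λ)
  (hβ : ∀ x d t t', R.rel (β x) d ((Family.ofMap (𝟙 (mapComplex T R.diagram))).vert d v t)
    ((Family.ofMap (𝟙 (mapComplex T R.diagram))).vert d x t'))

lemma contractionFamily_vert_zero (d : D) (x : (mapComplex T R.diagram ⊗ Δ[1] : SSet.{u}) _⦋0⦌)
    (t : (T.obj d) _⦋0⦌) (hx : x.2 0 = 0) : (contractionFamily v β hβ).vert d x t =
      (Family.ofMap (𝟙 (mapComplex T R.diagram))).vert d v t :=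
  if_pos hx

lemma contractionFamily_vert_one (d : D) (x : (mapComplex T R.diagram ⊗ Δ[1] : SSet.{u}) _⦋0⦌)
    (t : (T.obj d) _⦋0⦌) (hx : x.2 0 ≠ 0) : (contractionFamily v β hβ).vert d x t =
      (Family.ofMap (𝟙 (mapComplex T R.diagram))).vert d x.1 t :=
  if_neg hx

lemma contractionFamily_label_zero (d : D) (x : (mapComplex T R.diagram ⊗ Δ[1] : SSet.{u}) _⦋1⦌)
    (t : (T.obj d) _⦋1⦌) (hx : x.2 0 = 0) (hx' : x.2 1 = 0) :
    (contractionFamily v β hβ).label d x t =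
      (Family.ofMap (𝟙 (mapComplex T R.diagram))).label d
        ((mapComplex T R.diagram).map (SimplexCategory.σ 0).op v) t :=
  (if_pos hx).trans (if_pos hx')

lemma contractionFamily_label_one (d : D) (x : (mapComplex T R.diagram ⊗ Δ[1] : SSet.{u}) _⦋1⦌)
    (t : (T.obj d) _⦋1⦌) (hx : x.2 0 ≠ 0) : (contractionFamily v β hβ).label d x t =
      (Family.ofMap (𝟙 (mapComplex T R.diagram))).label d x.1 t :=
  if_neg hx

-- The criterion for contractibility: a vertex `v` such that for each `x` one label relates every
-- value of `v` to every value of `x`. Values at distinct `t`, `t'` must be allowed because an edge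
-- of `T` moves `t` during the jump.
include hβ in
lemma isContractible_mapComplex : (mapComplex T R.diagram).IsContractible := by
  refine SSet.isContractible_of_homotopy v (SSet.Homotopy.mk' (contractionFamily v β hβ).toMap
    (hom_ext_family (fun d x t ↦ ?_) fun d x t ↦ ?_)
    (hom_ext_family (fun d x t ↦ ?_) fun d x t ↦ ?_))
  · rw [Family.ofMap_comp_vert, Family.ofMap_toMap_vert]
    rw [contractionFamily_vert_zero _ _ _ _ _ _ rfl]
    exact congrArg ((Family.ofMap (𝟙 (mapComplex T R.diagram))).vert d · t)
      (SSet.const_app_zero v x).symm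
  · rw [Family.ofMap_comp_label, Family.ofMap_toMap_label]
    rw [contractionFamily_label_zero _ _ _ _ _ _ rfl rfl]
    refine congrArg ((Family.ofMap (𝟙 (mapComplex T R.diagram))).label d · t) ?_
    refine congrArg (fun θ : ⦋1⦌ ⟶ ⦋0⦌ ↦ (mapComplex T R.diagram).map θ.op v) ?_
    ext j
    exact congrArg Fin.val (Subsingleton.elim (α := Fin 1) _ _)
  · rw [Family.ofMap_comp_vert, Family.ofMap_toMap_vert]
    exact contractionFamily_vert_one v β hβ d _ t one_ne_zero
  · rw [Family.ofMap_comp_label, Family.ofMap_toMap_label]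
    exact contractionFamily_label_one v β hβ d _ t one_ne_zero

end Contraction

/-- The family of vertices associated to a map of diagrams of sets. -/
def vertexFamily (g : ∀ d, (T.obj d) _⦋0⦌ → W.obj d)
    (hg : ∀ {d d'} (f : d ⟶ d') t, g d' ((T.map f).app _ t) = W.map f (g d t)) (l : Λ)
    (hl : ∀ d t, R.rel l d (g d ((T.obj d).map (SimplexCategory.δ 1).op t))
      (g d ((T.obj d).map (SimplexCategory.δ 0).op t))) :
    Family R T (SSet.constant PUnit.{u + 1}) where
  vert d _ t := g d t
  vert_map f _ t := hg f t
  label _ _ _ := l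
  label_map _ _ _ := rfl
  rel d _ t := hl d t

lemma exists_vertex (g : ∀ d, (T.obj d) _⦋0⦌ → W.obj d)
    (hg : ∀ {d d'} (f : d ⟶ d') t, g d' ((T.map f).app _ t) = W.map f (g d t)) (l : Λ)
    (hl : ∀ d t, R.rel l d (g d ((T.obj d).map (SimplexCategory.δ 1).op t))
      (g d ((T.obj d).map (SimplexCategory.δ 0).op t))) :
    ∃ v : (mapComplex T R.diagram) _⦋0⦌,
      ∀ d t, (Family.ofMap (𝟙 (mapComplex T R.diagram))).vert d v t = g d t :=
  ⟨(vertexFamily g hg l hl).toMap.app _ PUnit.unit, fun d t ↦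
    (vertexFamily g hg l hl).ofMap_toMap_vert d PUnit.unit t⟩

end LabelledRel

end SpaceDiagram

end

/-! ### Orbits of simplicial sets and the test diagrams of labelled graphs -/

section

open Opposite Simplicial

namespace SpaceDiagram

variable {D : Type u} [SmallCategory D]

section SSet

/-- Simplicial sets are a category of spaces. -/
noncomputable def ssetProperties : SpaceProperties SSet.{u} where
  fullyFaithful := Functor.FullyFaithful.id _
  zeroIso := (curriedTensor SSet.{u}).mapIso
    (SSet.stdSimplex.isTerminalObj₀.uniqueUpToIso
      (CartesianMonoidalCategory.isTerminalTensorUnit (C := SSet.{u}))) ≪≫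
    MonoidalCategory.leftUnitorNatIso SSet.{u}
  empty := ⊥_ _
  isInitialEmpty := initialIsInitial
  point := ⊤_ _
  isTerminalPoint := terminalIsTerminal
  isTerminalInclPoint := (terminalIsTerminal : IsTerminal (⊤_ SSet.{u}))

/-- Colimits of simplicial sets are computed degreewise, so a cocone of sets under the `n`-simplices
factors through a one-point set. -/
lemma IsOrbit.isConnectedDiagram_sset {T : D ⥤ SSet.{u}} (hT : IsOrbit T) (n : SimplexCategoryᵒᵖ) :
    IsConnectedDiagram (T ⋙ (evaluation _ _).obj n) := by
  obtain ⟨c, ⟨hc⟩, ⟨hc'⟩⟩ := hT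
  intro Q g hg d d' x x'
  let s : Cocone (T ⋙ (evaluation _ _).obj n) :=
    { pt := Q
      ι := { app := fun d ↦ ↾(g d)
             naturality := fun d d' f ↦ by
              ext x
              exact hg f x } }
  let hc₁ := isColimitOfPreserves ((evaluation SimplexCategoryᵒᵖ (Type u)).obj n) hc
  have h : ∀ d x, hc₁.desc s ((c.ι.app d).app n x) = g d x := fun d x ↦
    ConcreteCategory.congr_hom (hc₁.fac s d) x
  have hs : Subsingleton (c.pt.obj n) := by
    have := IsTerminal.isTerminalObj ((evaluation SimplexCategoryᵒᵖ (Type u)).obj n) _ hc'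
    exact (Types.isTerminalEquivUnique _ this).instSubsingleton
  rw [← h, ← h]
  exact congrArg _ (hs.elim _ _)

lemma IsRegularOrbit.exists_pointOf_sset {T : D ⥤ SSet.{u}} (hT : IsRegularOrbit T)
    (n : SimplexCategoryᵒᵖ) : Nonempty (PointOf (T ⋙ (evaluation _ _).obj n)) := by
  obtain ⟨-, P, ⟨hP⟩, ⟨f⟩⟩ := hT
  let q : (Functor.const D).obj (SSet.constant PUnit.{u + 1}) ⟶ T := hP.from _ ≫ f
  exact ⟨{ pt := fun d ↦ (q.app d).app n PUnit.unit
           map_pt := fun d d' f ↦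
             (ConcreteCategory.congr_hom (congr_app (q.naturality f) n) PUnit.unit).symm }⟩

/-- A diagram of sets, as a diagram of constant simplicial sets. -/
def constantDiagram (W : D ⥤ Type u) : D ⥤ SSet.{u} where
  obj d := SSet.constant (W.obj d)
  map f := { app := fun _ ↦ W.map f }
  map_id d := by
    ext n x
    exact Functor.map_id_apply W d x
  map_comp f g := by
    ext n x
    exact Functor.map_comp_apply W f g x

/-- By connectedness, in each degree a cocone takes only its value at `p.pt d₀`; the point over `d₀`
also ensures that the colimit is nonempty. -/
lemma isOrbit_constantDiagram {W : D ⥤ Type u} (hW : IsConnectedDiagram W) (p : PointOf W) (d₀ : D) :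
    IsOrbit (constantDiagram W) := by
  refine ⟨{ pt := SSet.constant PUnit
            ι := { app := fun d ↦ SSet.toConstant (fun _ _ ↦ PUnit.unit) (fun _ _ ↦ rfl)
                   naturality := fun _ _ _ ↦ rfl } }, ⟨?_⟩, ⟨?_⟩⟩
  · have key : ∀ (s : Cocone (constantDiagram W)) (d : D) (n : SimplexCategoryᵒᵖ) (x : W.obj d),
        (s.ι.app d).app n x = (s.ι.app d₀).app n (p.pt d₀) := fun s d n x ↦
      hW (Q := s.pt.obj n) (fun d x ↦ (s.ι.app d).app n x) (fun d d' f x ↦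
        ConcreteCategory.congr_hom (congr_app (s.w f) n) x) d d₀ x (p.pt d₀)
    exact
      { desc := fun s ↦
          { app := fun n ↦ ↾fun _ ↦ (s.ι.app d₀).app n (p.pt d₀)
            naturality := fun n m θ ↦ by
              ext x
              exact NatTrans.naturality_apply (s.ι.app d₀) θ (p.pt d₀) }
        fac := fun s d ↦ by
          ext n x
          exact (key s d n x).symm
        uniq := fun s m hm ↦ by
          ext n x
          exact ConcreteCategory.congr_hom (congr_app (hm d₀) n) (p.pt d₀) }
  · exact IsTerminal.ofUniqueHom
      (fun X ↦ SSet.toConstant (fun _ _ ↦ PUnit.unit) (fun _ _ ↦ rfl)) (fun X m ↦ rfl)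

lemma LabelledRel.exists_isWeakEquivalence {R : Type u} {W : D ⥤ Type u} (ρ : LabelledRel W R)
    {B : Set (D ⥤ SSet.{u})} (hB : DetectsContractibility B)
    (hρ : ∀ b ∈ B, (mapComplex b ρ.diagram).IsContractible) {U : D ⥤ SSet.{u}} (hU : IsOrbit U) :
    Nonempty (U ⟶ ρ.diagram) ∧ ∀ {Q : Type u} (a : mapComplex U ρ.diagram ⟶ SSet.constant Q)
      (x y : (mapComplex U ρ.diagram) _⦋0⦌), (a.app _ x : Q) = a.app _ y := by
  have iso (T : D ⥤ SSet.{u}) : mapComplex T ρ.diagram ≅ funComplex T ρ.diagram :=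
    mapComplexIso T (Functor.rightUnitor ρ.diagram).symm
  obtain ⟨h₁, h₂⟩ := ssetProperties.exists_isWeakEquivalence hB ρ.diagram
    (fun T _ ↦ (LabelledRel.hasHornFilling_mapComplex T ρ).of_iso (iso T))
    (fun b hb ↦ (hρ b hb).of_iso (iso b)) hU
  refine ⟨h₁, fun a x y ↦ ?_⟩
  have h := h₂ ((iso U).inv ≫ a) ((iso U).hom.app _ x) ((iso U).hom.app _ y)
  have e : (iso U).hom ≫ (iso U).inv ≫ a = a := by simp
  have e' : ∀ z, ((iso U).hom ≫ (iso U).inv ≫ a).app (op ⦋0⦌) z =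
      ((iso U).inv ≫ a).app _ ((iso U).hom.app _ z) := fun z ↦ rfl
  rw [← e', ← e', e] at h
  exact h

/-- The relation for which all vertices are related. -/
def LabelledRel.total (W : D ⥤ Type u) : LabelledRel W PUnit.{u + 1} where
  rel _ _ _ _ := True
  refl _ _ _ := trivial
  symm _ := trivial
  map _ _ _ _ := trivial
  join _ _ := PUnit.unit
  trans _ _ := trivial

/-- Two elements of the wedge are related by a label if they agree or are both supported in it. -/
def LabelledRel.wedge {t : D ⥤ Type u} (p : PointOf t) {c : Cardinal.{u}} (hc : Cardinal.aleph0 ≤ c) :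
    LabelledRel (wedge p (BigIndex c)) (Label c) where
  rel A _ f g := f = g ∨ Wedge.supp f ⊆ A.1 ∧ Wedge.supp g ⊆ A.1
  refl _ _ _ := Or.inl rfl
  symm h := h.elim (fun h ↦ Or.inl h.symm) fun h ↦ Or.inr h.symm
  map φ _ _ h := h.elim (fun h ↦ Or.inl (congrArg _ h)) fun h ↦
    Or.inr ⟨(Wedge.supp_map φ _).trans h.1, (Wedge.supp_map φ _).trans h.2⟩
  join := Label.union hc
  trans {A A' d f g k} h h' := by
    have hA : A.1 ⊆ (A.union hc A').1 := Set.subset_union_left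
    have hA' : A'.1 ⊆ (A.union hc A').1 := Set.subset_union_right
    obtain rfl | h := h
    · exact h'.imp_right fun h' ↦ ⟨h'.1.trans hA', h'.2.trans hA'⟩
    · obtain rfl | h' := h'
      · exact Or.inr ⟨h.1.trans hA, h.2.trans hA⟩
      · exact Or.inr ⟨h.1.trans hA, h'.2.trans hA'⟩

end SSet

end SpaceDiagram

end

/-! ### Regular orbits of simplicial sets -/

section

open Opposite Simplicial

namespace SpaceDiagram

variable {D : Type u} [SmallCategory D]

/-- The coproduct of diagrams of sets. -/
def sigmaDiagram {I : Type u} (F : I → D ⥤ Type u) : D ⥤ Type u where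
  obj d := Σ i, (F i).obj d
  map f := ↾fun x ↦ ⟨x.1, (F x.1).map f x.2⟩
  map_id d := by
    refine ConcreteCategory.hom_ext _ _ fun x ↦ ?_
    exact congrArg (fun y : (F x.1).obj d ↦ (⟨x.1, y⟩ : Σ i, (F i).obj d))
      (Functor.map_id_apply (F x.1) d x.2)
  map_comp f g := by
    refine ConcreteCategory.hom_ext _ _ fun x ↦ ?_
    exact congrArg (fun y : (F x.1).obj _ ↦ (⟨x.1, y⟩ : Σ i, (F i).obj _))
      (Functor.map_comp_apply (F x.1) f g x.2)

/-- The index of the summand is a cocone under `t`, hence constant, so the image of `p` stays in one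
summand. -/
lemma IsConnectedDiagram.exists_pointOf {t : D ⥤ Type u} (ht : IsConnectedDiagram t)
    (p : PointOf t) (d₀ : D) {I : Type u} (F : I → D ⥤ Type u)
    (f : ∀ d, t.obj d → Σ i, (F i).obj d)
    (hf : ∀ ⦃d d'⦄ (φ : d ⟶ d') x, f d' (t.map φ x) = (sigmaDiagram F).map φ (f d x)) :
    ∃ i, Nonempty (PointOf (F i)) := by
  have h : ∀ d, ∃ y, f d (p.pt d) = ⟨(f d₀ (p.pt d₀)).1, y⟩ := fun d ↦ by
    have h := ht (fun d x ↦ (f d x).1) (fun d d' φ x ↦ congrArg Sigma.fst (hf φ x)) d d₀ (p.pt d)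
      (p.pt d₀)
    rw [← h]
    exact ⟨_, rfl⟩
  generalize (f d₀ (p.pt d₀)).1 = i at h
  choose y hy using h
  refine ⟨i, ⟨{ pt := y, map_pt := fun d d' φ ↦ ?_ }⟩⟩
  have h : (⟨i, (F i).map φ (y d)⟩ : Σ i, (F i).obj d') = ⟨i, y d'⟩ :=
    (congrArg ((sigmaDiagram F).map φ) (hy d).symm).trans
      ((hf φ _).symm.trans ((congrArg (f d') (p.map_pt φ)).trans (hy d')))
  exact eq_of_heq (Sigma.mk.inj h).2

section SSet

lemma IsOrbit.nonempty_sset {T : D ⥤ SSet.{u}} (hT : IsOrbit T) : Nonempty D := by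
  obtain ⟨c, ⟨hc⟩, ⟨hc'⟩⟩ := hT
  by_contra hD
  rw [not_nonempty_iff] at hD
  let s : Cocone T :=
    { pt := SSet.constant PEmpty
      ι := { app := fun d ↦ hD.elim d
             naturality := fun d ↦ hD.elim d } }
  exact PEmpty.elim ((hc.desc s).app (op ⦋0⦌)
    ((hc'.from (SSet.constant PUnit.{u + 1})).app (op ⦋0⦌) PUnit.unit))

variable {B : Set (D ⥤ SSet.{u})} {T : D ⥤ SSet.{u}}

/-- The test diagram is the indiscrete one on the coproduct of the vertex sets of `B`: maps into it
form a contractible complex as soon as there is one, and each `b` has its summand inclusion. Hence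
`T` maps to it. -/
lemma exists_pointOf_sset [Small.{u} B] (hB : DetectsContractibility B) (hT : IsRegularOrbit T) :
    ∃ b ∈ B, Nonempty (PointOf (b ⋙ (evaluation _ _).obj (op ⦋0⦌))) := by
  let F (i : Shrink.{u} B) := ((equivShrink B).symm i).1 ⋙ (evaluation _ _).obj (op ⦋0⦌)
  let ρ := LabelledRel.total (sigmaDiagram F)
  obtain ⟨d₀⟩ := hT.1.nonempty_sset
  obtain ⟨p⟩ := hT.exists_pointOf_sset (op ⦋0⦌)
  obtain ⟨⟨f⟩, -⟩ := ρ.exists_isWeakEquivalence hB (fun b hb ↦ by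
    let i := equivShrink B ⟨b, hb⟩
    have hi : ((equivShrink B).symm i).1 = b := by simp [i]
    obtain ⟨v, -⟩ := LabelledRel.exists_vertex (T := ((equivShrink B).symm i).1) (R := ρ)
      (fun d t ↦ ⟨i, t⟩) (fun _ _ ↦ rfl) PUnit.unit (fun _ _ ↦ trivial)
    rw [← hi]
    exact LabelledRel.isContractible_mapComplex v (fun _ ↦ PUnit.unit) (fun _ _ _ _ ↦ trivial))
    hT.1
  obtain ⟨i, hi⟩ := (hT.1.isConnectedDiagram_sset (op ⦋0⦌)).exists_pointOf p d₀ F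
    (fun d x ↦ LabelledRel.Simplex.vert ((f.app d).app (op ⦋0⦌) x) (𝟙 _))
    (fun d d' φ x ↦ congrArg (fun s : ρ.Simplex d' ⦋0⦌ ↦ s.vert (𝟙 _))
      (ConcreteCategory.congr_hom (congr_app (f.naturality φ) (op ⦋0⦌)) x))
  exact ⟨_, ((equivShrink B).symm i).2, hi⟩

/-- The supports of a family of maps to the wedge are bounded by a label. -/
def IsBounded {t : D ⥤ Type u} {p : PointOf t} {c : Cardinal.{u}} {X : D → Type u}
    (v : ∀ d, X d → Wedge p (BigIndex c) d) : Prop :=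
  ∃ A : Label c, ∀ d x, Wedge.supp (v d x) ⊆ A.1

lemma IsBounded.of_rel {t : D ⥤ Type u} {p : PointOf t} {c : Cardinal.{u}}
    (hc : Cardinal.aleph0 ≤ c) {X : D → Type u} {v v' : ∀ d, X d → Wedge p (BigIndex c) d}
    (hv : IsBounded v) (A : Label c)
    (h : ∀ d x, (LabelledRel.wedge p hc).rel A d (v d x) (v' d x)) : IsBounded v' := by
  obtain ⟨A', hA'⟩ := hv
  refine ⟨A.union hc A', fun d x ↦ ?_⟩
  obtain h | h := h d x
  · rw [← h]
    exact (hA' d x).trans Set.subset_union_right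
  · exact h.2.trans Set.subset_union_left

/-- The size argument: with a second element in `T`, the wedge of many copies is an orbit too large
for `B` to control. Boundedness of supports is an invariant of components of its function complex
that separates the constant map from the tautological one. -/
lemma subsingleton_of_detectsContractibility_sset [Small.{u} B] (hB : DetectsContractibility B)
    (hT : IsRegularOrbit T) (d : D) (n : SimplexCategoryᵒᵖ) : Subsingleton ((T.obj d).obj n) := by
  obtain ⟨p⟩ := hT.exists_pointOf_sset n
  suffices h : ∀ x, x = p.pt d from ⟨fun x y ↦ (h x).trans (h y).symm⟩
  intro x
  by_contra hx
  obtain ⟨c, hc, hc'⟩ := exists_cardinal.{u} (fun b : B ↦ Σ d, (b.1.obj d) _⦋0⦌)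
  let ρ := LabelledRel.wedge p hc
  let W := wedge p (BigIndex c)
  have hW : IsConnectedDiagram W := isConnectedDiagram_wedge (hT.1.isConnectedDiagram_sset n)
  obtain ⟨-, h⟩ := ρ.exists_isWeakEquivalence hB (fun b hb ↦ by
    obtain ⟨v, hv⟩ := LabelledRel.exists_vertex (T := b) (R := ρ)
      (fun d _ ↦ (wedgeBase p (BigIndex c)).pt d) (fun φ _ ↦ ((wedgeBase p _).map_pt φ).symm)
      default (fun d _ ↦ ρ.refl _ _ _)
    -- Since `b` has at most `c` vertices, the supports of their images under `x` all fit in one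
    -- label, which relates `x` to the base point.
    have hβ : ∀ x : (mapComplex b ρ.diagram) _⦋0⦌, ∃ A : Label c, ∀ y : Σ d, (b.obj d) _⦋0⦌,
        Wedge.supp (p := p) ((LabelledRel.Family.ofMap (𝟙 (mapComplex b ρ.diagram))).vert y.1 x y.2)
          ⊆ A.1 := fun x ↦
      Label.exists_bound (hc' ⟨b, hb⟩) _ fun y ↦ Wedge.subsingleton _
    choose β hβ using hβ
    refine LabelledRel.isContractible_mapComplex v β fun x d t t' ↦ Or.inr ⟨?_, hβ x ⟨d, t'⟩⟩
    rw [hv, supp_wedgeBase]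
    exact Set.empty_subset _)
    (isOrbit_constantDiagram hW (wedgeBase p _) d)
  let U := constantDiagram W
  let F := LabelledRel.Family.ofMap (𝟙 (mapComplex U ρ.diagram))
  let P (y : (mapComplex U ρ.diagram) _⦋0⦌) : Prop :=
    IsBounded (p := p) (X := fun d ↦ (U.obj d) _⦋0⦌) fun d t ↦ F.vert d y t
  have hP : ∀ e : (mapComplex U ρ.diagram) _⦋1⦌,
      P ((mapComplex U ρ.diagram).map (SimplexCategory.δ 1).op e) ↔
        P ((mapComplex U ρ.diagram).map (SimplexCategory.δ 0).op e) := fun e ↦ by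
    let A := F.label d e ((wedgeBase p (BigIndex c)).pt d)
    -- Labels are invariant under `D` and `W` is connected, so a path of maps out of `W` carries a
    -- single label.
    have hA : ∀ d' t, F.label d' e t = A := fun d' t ↦
      hW (fun d t ↦ F.label d e t) (fun d d' φ t ↦ F.label_map φ e t) d' d t _
    have key := fun d' t ↦ F.rel d' e t
    simp only [hA] at key
    exact ⟨fun h ↦ h.of_rel hc A key, fun h ↦ h.of_rel hc A fun d t ↦ ρ.symm (key d t)⟩
  obtain ⟨v₀, hv₀⟩ := LabelledRel.exists_vertex (T := U) (R := ρ)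
    (fun d _ ↦ (wedgeBase p (BigIndex c)).pt d) (fun φ _ ↦ ((wedgeBase p _).map_pt φ).symm)
    default (fun d _ ↦ ρ.refl _ _ _)
  obtain ⟨v₁, hv₁⟩ := LabelledRel.exists_vertex (T := U) (R := ρ)
    (fun d w ↦ w) (fun φ _ ↦ rfl) default (fun d _ ↦ ρ.refl _ _ _)
  have h₀ : P v₀ := ⟨default, fun d t ↦ by
    change Wedge.supp (F.vert d v₀ t) ⊆ _
    rw [hv₀, supp_wedgeBase]
    exact Set.empty_subset _⟩
  have h₁ : P v₁ := by
    have := h (SSet.toConstantOfEdges P hP) v₀ v₁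
    rw [SSet.toConstantOfEdges_app_zero, SSet.toConstantOfEdges_app_zero] at this
    exact (congrArg ULift.down this).mp h₀
  obtain ⟨A, hA⟩ := h₁
  obtain ⟨w, hw⟩ := Wedge.exists_not_supp_subset hx A.ne_univ
  exact hw ((congrArg (Wedge.supp (p := p)) (hv₁ d w)).symm.subset.trans (hA d w))

/-- Since `T` is trivial, the constant map at a point of `b` and the unique map back exhibit it as a
retract of `b`. -/
theorem isColocal_sset [Small.{u} B] (hB : DetectsContractibility B) (hT : IsRegularOrbit T) :
    IsColocal B T := by
  obtain ⟨b, hb, ⟨q⟩⟩ := exists_pointOf_sset hB hT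
  have hT' := subsingleton_of_detectsContractibility_sset hB hT
  let p n := (hT.exists_pointOf_sset n).some
  refine isColocal_of_retract (ssetProperties.isCofibrant_of_isOrbit hT.1) hb
    { app := fun d ↦ SSet.const (q.pt d)
      naturality := fun d d' f ↦ ?_ }
    { app := fun d ↦
        { app := fun n ↦ ↾fun _ ↦ (p n).pt d
          naturality := fun n m θ ↦ by
            ext x
            exact (hT' _ _).elim _ _ }
      naturality := fun d d' f ↦ by
        ext n x
        exact (hT' _ _).elim _ _ } ?_
  · ext n x
    have h := NatTrans.naturality_apply (b.map f) (SimplexCategory.const n.unop ⦋0⦌ 0).op (q.pt d)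
    refine Eq.trans ?_ h.symm
    exact congrArg ((b.obj d').map (SimplexCategory.const n.unop ⦋0⦌ 0).op) (q.map_pt f).symm
  · ext d n x
    exact (hT' _ _).elim _ _

end SSet

end SpaceDiagram

end

section

open Opposite Simplicial

/-! ### Function complexes of diagrams of topological spaces -/

namespace SpaceDiagram

variable {D : Type u} [SmallCategory D]

/-- The geometric simplex. -/
abbrev geomSimplex (n : SimplexCategory) : Type := stdSimplex ℝ (Fin (n.len + 1))

/-- The map of geometric simplices induced by a map in the simplex category. -/
noncomputable abbrev geomMap {n m : SimplexCategory} (θ : n ⟶ m) :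
    geomSimplex n → geomSimplex m := stdSimplex.map θ

lemma geomMap_comp {n m k : SimplexCategory} (θ : n ⟶ m) (θ' : m ⟶ k) (x : geomSimplex n) :
    geomMap (θ ≫ θ') x = geomMap θ' (geomMap θ x) := by
  rw [geomMap, geomMap, geomMap, stdSimplex.map_comp_apply]
  rfl

lemma geomMap_id (n : SimplexCategory) (x : geomSimplex n) : geomMap (𝟙 n) x = x :=
  stdSimplex.map_id_apply x

/-- The natural families of continuous maps `Δ^n × T ⟶ Y`. -/
@[ext]
structure ContinuousFamily (T Y : D ⥤ TopCat.{u}) (n : SimplexCategory) : Type u where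
  /-- The maps. -/
  toFun (d : D) : geomSimplex n → T.obj d → Y.obj d
  continuous_toFun (d : D) : Continuous (fun x : geomSimplex n × T.obj d ↦ toFun d x.1 x.2)
  toFun_map {d d' : D} (f : d ⟶ d') (x : geomSimplex n) (t : T.obj d) :
    toFun d' x (T.map f t) = Y.map f (toFun d x t)

/-- The restriction of a family of maps. -/
noncomputable def ContinuousFamily.comp {T Y : D ⥤ TopCat.{u}} {n m : SimplexCategory}
    (φ : ContinuousFamily T Y n) (θ : m ⟶ n) : ContinuousFamily T Y m where
  toFun d x t := φ.toFun d (geomMap θ x) t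
  continuous_toFun d := (φ.continuous_toFun d).comp
    (((stdSimplex.continuous_map θ).comp continuous_fst).prodMk continuous_snd)
  toFun_map f _ t := φ.toFun_map f _ t

/-- The simplicial function complex of diagrams of topological spaces. -/
noncomputable def continuousComplex (T Y : D ⥤ TopCat.{u}) : SSet.{u} where
  obj n := ContinuousFamily T Y n.unop
  map θ := ↾fun φ ↦ φ.comp θ.unop
  map_id n := by
    refine ConcreteCategory.hom_ext _ _ fun φ ↦ ?_
    ext d x t
    exact congrArg (φ.toFun d · t) (geomMap_id _ x)
  map_comp θ θ' := by
    refine ConcreteCategory.hom_ext _ _ fun φ ↦ ?_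
    ext d x t
    exact congrArg (φ.toFun d · t) (geomMap_comp _ _ x)

/-! ### Retraction of the geometric simplex to a horn -/

section Horn

variable {n : ℕ} (k : Fin (n + 2))

/-- The least coordinate of a point of a simplex, other than the `k`-th. -/
noncomputable def minCoord (x : stdSimplex ℝ (Fin (n + 2))) : ℝ :=
  Finset.univ.inf' Finset.univ_nonempty fun j : Fin (n + 1) ↦ x (k.succAbove j)

lemma minCoord_le (x : stdSimplex ℝ (Fin (n + 2))) {j : Fin (n + 2)} (hj : j ≠ k) :
    minCoord k x ≤ x j := by
  obtain ⟨j, rfl⟩ := Fin.exists_succAbove_eq hj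
  exact Finset.inf'_le _ (Finset.mem_univ j)

lemma minCoord_nonneg (x : stdSimplex ℝ (Fin (n + 2))) : 0 ≤ minCoord k x :=
  Finset.le_inf' _ _ fun _ _ ↦ stdSimplex.zero_le x _

lemma exists_minCoord_eq (x : stdSimplex ℝ (Fin (n + 2))) : ∃ j, j ≠ k ∧ x j = minCoord k x := by
  obtain ⟨j, -, hj⟩ := Finset.exists_mem_eq_inf' Finset.univ_nonempty
    fun j : Fin (n + 1) ↦ x (k.succAbove j)
  exact ⟨_, Fin.succAbove_ne k j, hj.symm⟩

lemma continuous_coord (j : Fin (n + 2)) :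
    Continuous fun x : stdSimplex ℝ (Fin (n + 2)) ↦ x j :=
  (continuous_apply j).comp continuous_subtype_val

lemma continuous_minCoord : Continuous (minCoord k) :=
  Continuous.finset_inf'_apply _ fun _ _ ↦ continuous_coord _

/-- The retraction of a geometric simplex to a horn. -/
noncomputable def geomRetraction (x : stdSimplex ℝ (Fin (n + 2))) :
    stdSimplex ℝ (Fin (n + 2)) :=
  -- Subtracting the least coordinate makes one of the `n + 1` coordinates other than `k` vanish;
  -- the mass removed goes to `k`.
  ⟨fun j ↦ if j = k then x k + (n + 1) * minCoord k x else x j - minCoord k x, fun j ↦ by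
    dsimp only
    split_ifs with h
    · have := minCoord_nonneg k x
      have := stdSimplex.zero_le x k
      positivity
    · exact sub_nonneg.2 (minCoord_le k x h), by
    have h := stdSimplex.sum_eq_one x
    rw [Fin.sum_univ_succAbove _ k] at h ⊢
    simp only [if_true, Fin.succAbove_ne, if_false, Finset.sum_sub_distrib, Finset.sum_const,
      Finset.card_univ, Fintype.card_fin, nsmul_eq_mul]
    push_cast
    linarith⟩

lemma geomRetraction_apply_of_ne (x : stdSimplex ℝ (Fin (n + 2))) {j : Fin (n + 2)} (hj : j ≠ k) :
    geomRetraction k x j = x j - minCoord k x :=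
  if_neg hj

lemma exists_geomRetraction_eq_zero (x : stdSimplex ℝ (Fin (n + 2))) :
    ∃ j, j ≠ k ∧ geomRetraction k x j = 0 := by
  obtain ⟨j, hj, h⟩ := exists_minCoord_eq k x
  exact ⟨j, hj, by rw [geomRetraction_apply_of_ne k x hj, h, sub_self]⟩

lemma geomRetraction_eq_self (x : stdSimplex ℝ (Fin (n + 2))) {j : Fin (n + 2)} (hj : j ≠ k)
    (h : x j = 0) : geomRetraction k x = x := by
  have hm : minCoord k x = 0 := le_antisymm ((minCoord_le k x hj).trans h.le) (minCoord_nonneg k x)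
  refine Subtype.ext (funext fun i ↦ ?_)
  change (if i = k then x k + (n + 1) * minCoord k x else x i - minCoord k x) = x i
  rw [hm]
  split_ifs with h
  · rw [h, mul_zero, add_zero]
  · rw [sub_zero]

lemma continuous_geomRetraction : Continuous (geomRetraction k) := by
  refine Continuous.subtype_mk (continuous_pi fun j ↦ ?_) _
  split_ifs
  · exact (continuous_coord k).add (continuous_const.mul (continuous_minCoord k))
  · exact (continuous_coord j).sub (continuous_minCoord k)

/-- A monotone retraction of `[n]` to a nonempty subset. -/
lemma exists_retraction (S : Finset (Fin (n + 2))) (hS : S.Nonempty) :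
    ∃ τ : ⦋n + 1⦌ ⟶ ⦋n + 1⦌, (∀ i, τ i ∈ S) ∧ ∀ i ∈ S, τ i = i := by
  have ne : ∀ j, (S.filter (· ≤ max j (S.min' hS))).Nonempty := fun j ↦
    ⟨S.min' hS, Finset.mem_filter.2 ⟨S.min'_mem hS, le_max_right _ _⟩⟩
  -- Each `j` goes to the largest element of `S` not above it, or to the least element of `S` when
  -- there is none.
  refine ⟨SimplexCategory.Hom.mk ⟨fun j ↦ (S.filter (· ≤ max j (S.min' hS))).max' (ne j), ?_⟩,
    fun i ↦ ?_, fun i hi ↦ ?_⟩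
  · intro i j hij
    refine Finset.max'_subset _ fun x hx ↦ ?_
    rw [Finset.mem_filter] at hx ⊢
    exact ⟨hx.1, hx.2.trans (max_le_max_right _ hij)⟩
  · exact (Finset.mem_filter.1 (Finset.max'_mem _ (ne i))).1
  · refine le_antisymm ?_ ?_
    · refine (Finset.mem_filter.1 (Finset.max'_mem _ (ne i))).2.trans ?_
      exact max_le le_rfl (S.min'_le _ hi)
    · exact Finset.le_max' _ _ (Finset.mem_filter.2 ⟨hi, le_max_left _ _⟩)

open Classical in
lemma geomMap_apply {n m : SimplexCategory} (θ : n ⟶ m) (x : geomSimplex n)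
    (j : Fin (m.len + 1)) : geomMap θ x j = ∑ i, if θ i = j then x i else 0 := by
  rw [stdSimplex.map_coe, FunOnFinite.linearMap_apply_apply, Finset.sum_filter]

lemma geomMap_eq_self {τ : ⦋n + 1⦌ ⟶ ⦋n + 1⦌} {S : Finset (Fin (n + 2))} (hτ : ∀ i ∈ S, τ i = i)
    (x : geomSimplex ⦋n + 1⦌) (hx : ∀ i ∉ S, x i = 0) : geomMap τ x = x := by
  classical
  refine Subtype.ext (funext fun j ↦ ?_)
  refine (geomMap_apply τ x j).trans ?_
  refine (Finset.sum_congr rfl (g := fun i ↦ if i = j then x i else 0) fun i _ ↦ ?_).trans ?_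
  · by_cases hi : i ∈ S
    · rw [hτ i hi]
    · rw [hx i hi, ite_self, ite_self]
  · exact Finset.sum_ite_eq' Finset.univ j x |>.trans (if_pos (Finset.mem_univ _))

lemma geomMap_apply_eq_zero {n m : SimplexCategory} (θ : n ⟶ m) (x : geomSimplex n)
    (j : Fin (m.len + 1)) (hj : ∀ i, θ i ≠ j) : geomMap θ x j = 0 := by
  classical
  rw [geomMap_apply]
  exact Finset.sum_eq_zero fun i _ ↦ if_neg (hj i)

variable {k}

/-- The simplex of a horn given by a map whose image misses a vertex. -/
def hornSimplex {m : SimplexCategory} (σ : m ⟶ ⦋n + 1⦌) {j : Fin (n + 2)} (hj : j ≠ k)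
    (hσ : ∀ i, σ i ≠ j) : (Λ[n + 1, k] : SSet.{u}).obj (op m) :=
  ⟨SSet.stdSimplex.objEquiv.symm σ, by
    obtain ⟨m⟩ := m
    rw [SSet.mem_horn_iff_notMem_range]
    exact ⟨j, hj, fun ⟨i, hi⟩ ↦ hσ i hi⟩⟩

variable {T Y : D ⥤ TopCat.{u}} (a : (Λ[n + 1, k] : SSet.{u}) ⟶ continuousComplex T Y)

/-- The family of maps given by a simplex of a horn. -/
def hornFamily {m : SimplexCategory} (σ : m ⟶ ⦋n + 1⦌) {j : Fin (n + 2)} (hj : j ≠ k)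
    (hσ : ∀ i, σ i ≠ j) : ContinuousFamily T Y m :=
  a.app (op m) (hornSimplex σ hj hσ)

lemma hornFamily_comp {m m' : SimplexCategory} (θ : m' ⟶ m) (σ : m ⟶ ⦋n + 1⦌) {j : Fin (n + 2)}
    (hj : j ≠ k) (hσ : ∀ i, σ i ≠ j) {j' : Fin (n + 2)} (hj' : j' ≠ k)
    (hσ' : ∀ i, (θ ≫ σ) i ≠ j') (d : D) (x : geomSimplex m') (t : T.obj d) :
    (hornFamily a (θ ≫ σ) hj' hσ').toFun d x t =
      (hornFamily a σ hj hσ).toFun d (geomMap θ x) t :=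
  congrArg (fun φ : ContinuousFamily T Y m' ↦ φ.toFun d x t)
    (NatTrans.naturality_apply a θ.op (hornSimplex σ hj hσ))

/-- A retraction to the face opposite to a vertex. -/
noncomputable def faceRetraction (j : Fin (n + 2)) : ⦋n + 1⦌ ⟶ ⦋n + 1⦌ :=
  (exists_retraction ({j}ᶜ : Finset (Fin (n + 2))) ⟨j.succAbove 0, by simp⟩).choose

lemma faceRetraction_ne (j i : Fin (n + 2)) : faceRetraction j i ≠ j := by
  have := (exists_retraction ({j}ᶜ : Finset (Fin (n + 2))) ⟨j.succAbove 0, by simp⟩).choose_spec.1 i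
  rwa [Finset.mem_compl, Finset.mem_singleton] at this

lemma faceRetraction_of_ne {j i : Fin (n + 2)} (h : i ≠ j) : faceRetraction j i = i :=
  (exists_retraction ({j}ᶜ : Finset (Fin (n + 2))) ⟨j.succAbove 0, by simp⟩).choose_spec.2 i
    (by simpa using h)

/-- The extension of the map defined on a face of a horn. -/
noncomputable def faceFamily {j : Fin (n + 2)} (hj : j ≠ k) : ContinuousFamily T Y ⦋n + 1⦌ :=
  hornFamily a (faceRetraction j) hj (faceRetraction_ne j)

/-- A point with both coordinates zero is fixed by a simplicial retraction `τ` avoiding `i` and `j`.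
Both face families restrict along `τ` to the same simplex of the horn. -/
lemma faceFamily_eq {i j : Fin (n + 2)} (hi : i ≠ k) (hj : j ≠ k) (d : D)
    (x : geomSimplex ⦋n + 1⦌) (hxi : x i = 0) (hxj : x j = 0) (t : T.obj d) :
    (faceFamily a hi).toFun d x t = (faceFamily a hj).toFun d x t := by
  obtain ⟨τ, hτ, hτ'⟩ := exists_retraction ({i, j}ᶜ : Finset (Fin (n + 2)))
    ⟨k, by simp [hi.symm, hj.symm]⟩
  have h₁ : ∀ l, τ l ≠ i := fun l hl ↦ by simpa [hl] using hτ l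
  have h₂ : ∀ l, τ l ≠ j := fun l hl ↦ by simpa [hl] using hτ l
  have hx : geomMap τ x = x := geomMap_eq_self hτ' x fun l hl ↦ by
    obtain rfl | rfl : l = i ∨ l = j := by simpa [or_iff_not_imp_left] using hl
    exacts [hxi, hxj]
  have e : ∀ {j}, (∀ l, τ l ≠ j) → τ ≫ faceRetraction j = τ := fun h ↦ by
    ext l : 3
    exact faceRetraction_of_ne (h l)
  have key : ∀ {j} (hj : j ≠ k) (h : ∀ l, τ l ≠ j),
      (faceFamily a hj).toFun d x t = (hornFamily a τ hj h).toFun d x t := fun hj h ↦ by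
    have := hornFamily_comp a τ (faceRetraction _) hj (faceRetraction_ne _) hj
      (by rw [e h]; exact h) d x t
    rw [hx] at this
    refine this.symm.trans ?_
    congr 2
    exact e h
  rw [key hi h₁, key hj h₂]
  rfl

/-- The extension of a family of maps from a horn to a simplex. -/
noncomputable def hornExtension : ContinuousFamily T Y ⦋n + 1⦌ where
  toFun d x t := (faceFamily a (exists_geomRetraction_eq_zero k x).choose_spec.1).toFun d
    (geomRetraction k x) t
  continuous_toFun d := by
    -- The face was chosen without continuity. These finitely many closed sets cover, and on each
    -- the value agrees with one fixed face family.
    let C (j : { j : Fin (n + 2) // j ≠ k }) : Set (geomSimplex ⦋n + 1⦌ × T.obj d) :=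
      { x | geomRetraction k x.1 j.1 = 0 }
    refine (locallyFinite_of_finite C).continuous ?_ (fun j ↦ ?_) fun j ↦ ?_
    · refine Set.eq_univ_of_forall fun x ↦ ?_
      obtain ⟨j, hj, h⟩ := exists_geomRetraction_eq_zero k x.1
      exact Set.mem_iUnion.2 ⟨⟨j, hj⟩, h⟩
    · exact isClosed_eq ((continuous_coord j.1).comp
        ((continuous_geomRetraction k).comp continuous_fst)) continuous_const
    · refine Continuous.continuousOn (((faceFamily a j.2).continuous_toFun d).comp
        (((continuous_geomRetraction k).comp continuous_fst).prodMk continuous_snd)) |>.congr ?_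
      intro x hx
      exact faceFamily_eq a _ j.2 d _ (exists_geomRetraction_eq_zero k x.1).choose_spec.2 hx x.2
  toFun_map f x t := (faceFamily a _).toFun_map f _ t

lemma hasHornFilling_continuousComplex (T Y : D ⥤ TopCat.{u}) :
    (continuousComplex T Y).HasHornFilling := fun n k a ↦ by
  refine ⟨SSet.yonedaEquiv.symm (hornExtension a), ?_⟩
  ext ⟨m⟩ ⟨y, hy⟩
  obtain ⟨σ, rfl⟩ := SSet.stdSimplex.objEquiv.symm.surjective y
  obtain ⟨m⟩ := m
  obtain ⟨j, hj, hj'⟩ := (SSet.mem_horn_iff_notMem_range _ _).1 hy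
  have hσ : ∀ i, σ i ≠ j := fun i hi ↦ hj' ⟨i, hi⟩
  change (hornExtension a).comp σ = hornFamily a σ hj hσ
  refine ContinuousFamily.ext (funext fun d ↦ funext fun x ↦ funext fun t ↦ ?_)
  have h₀ := geomMap_apply_eq_zero σ x j hσ
  have h₁ := geomRetraction_eq_self k (geomMap σ x) hj h₀
  have e : σ ≫ faceRetraction j = σ := by
    ext l : 3
    exact faceRetraction_of_ne (hσ l)
  have h₂ := hornFamily_comp a σ (faceRetraction j) hj (faceRetraction_ne j) hj
    (by rw [e]; exact hσ) d x t
  have h₃ := faceFamily_eq a (exists_geomRetraction_eq_zero k (geomMap σ x)).choose_spec.1 hj d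
    (geomRetraction k (geomMap σ x))
    (exists_geomRetraction_eq_zero k (geomMap σ x)).choose_spec.2 (by rw [h₁]; exact h₀) t
  refine h₃.trans ?_
  rw [h₁]
  refine h₂.symm.trans ?_
  congr 2

end Horn

end SpaceDiagram

end

/-! ### The telescope -/

section

open Opposite

namespace SpaceDiagram

variable {D : Type u} [SmallCategory D]

section Telescope

variable {t : D ⥤ Type u} (p : PointOf t) (c : Cardinal.{u})

/-- A space which consists of the open points of the wedge, an open point `top`, and of points
between `top` and the points of the wedge, labelled by sets containing the support. -/
inductive Telescope (d : D) : Type u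
  | bot (w : Wedge p (BigIndex c) d)
  | mid (w : Wedge p (BigIndex c) d) (A : Label c) (h : w.supp ⊆ A.1)
  | top

namespace Telescope

variable {p c} {d : D}

/-- Points `bot w` and `top` are isolated, and the points `mid w A` for different `A` lie in exactly
the same open sets. Labels are thus invisible to continuity, while the maps of `D` still have to
preserve them. -/
instance : TopologicalSpace (Telescope p c d) where
  IsOpen U := ∀ w A h, mid w A h ∈ U → bot w ∈ U ∧ top ∈ U ∧ ∀ A' h', mid w A' h' ∈ U
  isOpen_univ _ _ _ _ := ⟨trivial, trivial, fun _ _ ↦ trivial⟩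
  isOpen_inter U V hU hV w A h hw :=
    ⟨⟨(hU w A h hw.1).1, (hV w A h hw.2).1⟩, ⟨(hU w A h hw.1).2.1, (hV w A h hw.2).2.1⟩,
      fun A' h' ↦ ⟨(hU w A h hw.1).2.2 A' h', (hV w A h hw.2).2.2 A' h'⟩⟩
  isOpen_sUnion S hS w A h := by
    rintro ⟨U, hU, hw⟩
    exact ⟨⟨U, hU, (hS U hU w A h hw).1⟩, ⟨U, hU, (hS U hU w A h hw).2.1⟩,
      fun A' h' ↦ ⟨U, hU, (hS U hU w A h hw).2.2 A' h'⟩⟩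

instance : AlexandrovDiscrete (Telescope p c d) where
  isOpen_sInter _ hS w A h hw :=
    ⟨fun U hU ↦ (hS U hU w A h (hw U hU)).1, fun U hU ↦ (hS U hU w A h (hw U hU)).2.1,
      fun A' h' U hU ↦ (hS U hU w A h (hw U hU)).2.2 A' h'⟩

/-- The smallest neighbourhood of `mid w A`. -/
def star (w : Wedge p (BigIndex c) d) : Set (Telescope p c d) :=
  { z | z = bot w ∨ z = top ∨ ∃ A h, z = mid w A h }

lemma isOpen_star (w : Wedge p (BigIndex c) d) : IsOpen (star w) := by
  rintro w' A h (h' | h' | ⟨A', h', e⟩)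
  · cases h'
  · cases h'
  · cases e
    exact ⟨Or.inl rfl, Or.inr (Or.inl rfl), fun A' h' ↦ Or.inr (Or.inr ⟨A', h', rfl⟩)⟩

lemma isOpen_top : IsOpen ({top} : Set (Telescope p c d)) := fun _ _ _ h ↦ by cases h

lemma isOpen_bot (S : Set (Wedge p (BigIndex c) d)) :
    IsOpen (bot '' S : Set (Telescope p c d)) := by
  rintro w A h ⟨w', -, h⟩
  cases h

/-- The sets `{bot w}`, `{top}` and `star w` are the smallest neighbourhoods of the points. -/
lemma continuous_iff {X : Type*} [TopologicalSpace X] (f : X → Telescope p c d) :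
    Continuous f ↔ (∀ w, IsOpen { x | f x = bot w }) ∧ IsOpen { x | f x = top } ∧
      ∀ w, IsOpen { x | f x ∈ star w } := by
  refine ⟨fun hf ↦ ⟨fun w ↦ ?_, ?_, fun w ↦ ?_⟩, fun ⟨h₁, h₂, h₃⟩ ↦ ⟨fun U hU ↦ ?_⟩⟩
  · convert (isOpen_bot {w}).preimage hf
    ext x
    simp
  · exact isOpen_top.preimage hf
  · exact (isOpen_star w).preimage hf
  · rw [isOpen_iff_forall_mem_open]
    intro x hx
    obtain ⟨w, hw⟩ | h | ⟨w, A, h, hw⟩ :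
        (∃ w, f x = bot w) ∨ f x = top ∨ ∃ w A h, f x = mid w A h := by
      cases f x with
      | bot w => exact Or.inl ⟨w, rfl⟩
      | mid w A h => exact Or.inr (Or.inr ⟨w, A, h, rfl⟩)
      | top => exact Or.inr (Or.inl rfl)
    · refine ⟨_, fun y hy ↦ ?_, h₁ w, hw⟩
      change f y ∈ U
      rw [show f y = bot w from hy, ← hw]
      exact hx
    · refine ⟨_, fun y hy ↦ ?_, h₂, h⟩
      change f y ∈ U
      rw [show f y = top from hy, ← h]
      exact hx
    · refine ⟨_, fun y hy ↦ ?_, h₃ w, ?_⟩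
      · change f x ∈ U at hx
        rw [hw] at hx
        have := hU w A h hx
        change f y ∈ U
        obtain e | e | ⟨A', h', e⟩ : f y ∈ star w := hy
        · rw [e]; exact this.1
        · rw [e]; exact this.2.1
        · rw [e]; exact this.2.2 _ _
      · change f x ∈ star w
        rw [hw]
        exact Or.inr (Or.inr ⟨A, h, rfl⟩)

/-- The support of a point. -/
def supp : Telescope p c d → Set (BigIndex c)
  | bot w => w.supp
  | mid w _ _ => w.supp
  | top => ∅

lemma supp_subsingleton : ∀ z : Telescope p c d, z.supp.Subsingleton
  | bot w => w.subsingleton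
  | mid w _ _ => w.subsingleton
  | top => Set.subsingleton_empty

/-- The height and the label of a point. -/
def level : Telescope p c d → Option (Option (Label c))
  | bot _ => none
  | mid _ A _ => some (some A)
  | top => some none

/-- The functoriality of the telescope. -/
def map {d' : D} (φ : d ⟶ d') : Telescope p c d → Telescope p c d'
  | bot w => bot ((wedge p (BigIndex c)).map φ w)
  | mid w A h => mid ((wedge p (BigIndex c)).map φ w) A ((Wedge.supp_map φ w).trans h)
  | top => top

lemma level_map {d' : D} (φ : d ⟶ d') (z : Telescope p c d) : (map φ z).level = z.level := by
  cases z <;> rfl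

lemma supp_map {d' : D} (φ : d ⟶ d') : ∀ z : Telescope p c d, (map φ z).supp ⊆ z.supp
  | bot w => Wedge.supp_map φ w
  | mid w _ _ => Wedge.supp_map φ w
  | top => subset_rfl

lemma continuous_map {d' : D} (φ : d ⟶ d') : Continuous (map (p := p) (c := c) φ) where
  isOpen_preimage _ hU _ _ _ hw :=
    ⟨(hU _ _ _ hw).1, (hU _ _ _ hw).2.1, fun _ _ ↦ (hU _ _ _ hw).2.2 _ _⟩

/-- Push a point of the telescope upwards. -/
def push (A : Label c) : ∀ z : Telescope p c d, z.supp ⊆ A.1 → Telescope p c d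
  | bot w, h => mid w A h
  | mid w _ _, h => mid w A h
  | top, _ => top

lemma push_map {d' : D} (φ : d ⟶ d') (A : Label c) (z : Telescope p c d) (hz : z.supp ⊆ A.1) :
    push A (map φ z) ((supp_map φ z).trans hz) = map φ (push A z hz) := by
  cases z <;> rfl

lemma push_ne_bot (A : Label c) (z : Telescope p c d) (hz : z.supp ⊆ A.1)
    (w : Wedge p (BigIndex c) d) : push A z hz ≠ bot w := by
  cases z <;> exact nofun

lemma push_eq_top (A : Label c) (z : Telescope p c d) (hz : z.supp ⊆ A.1) :
    push A z hz = top ↔ z = top := by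
  cases z
  · exact iff_of_false nofun nofun
  · exact iff_of_false nofun nofun
  · exact iff_of_true rfl rfl

lemma push_mem_star (A : Label c) (z : Telescope p c d) (hz : z.supp ⊆ A.1)
    (w : Wedge p (BigIndex c) d) : push A z hz ∈ star w ↔ z ∈ star w := by
  cases z with
  | bot w' =>
    constructor
    · rintro (h | h | ⟨A, h, e⟩)
      · cases h
      · cases h
      · cases e
        exact Or.inl rfl
    · rintro (h | h | ⟨A, h, e⟩)
      · cases h
        exact Or.inr (Or.inr ⟨_, _, rfl⟩)
      · cases h
      · cases e
  | mid w' A' h' =>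
    constructor
    · rintro (h | h | ⟨A, h, e⟩)
      · cases h
      · cases h
      · cases e
        exact Or.inr (Or.inr ⟨_, _, rfl⟩)
    · rintro (h | h | ⟨A, h, e⟩)
      · cases h
      · cases h
      · cases e
        exact Or.inr (Or.inr ⟨_, _, rfl⟩)
  | top => exact Iff.rfl

open Classical in
/-- The homotopy moving all points with support in a given set to the top. -/
noncomputable def lift (s : ℝ) (A : Label c) (z : Telescope p c d) (hz : z.supp ⊆ A.1) :
    Telescope p c d :=
  if s < 1 / 2 then z else if s = 1 / 2 then push A z hz else top

lemma lift_zero (A : Label c) (z : Telescope p c d) (hz : z.supp ⊆ A.1) : lift 0 A z hz = z :=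
  if_pos (by norm_num)

lemma lift_one (A : Label c) (z : Telescope p c d) (hz : z.supp ⊆ A.1) : lift 1 A z hz = top :=
  (if_neg (by norm_num)).trans (if_neg (by norm_num))

lemma lift_map {d' : D} (φ : d ⟶ d') (s : ℝ) (A : Label c) (z : Telescope p c d)
    (hz : z.supp ⊆ A.1) :
    lift s A (map φ z) ((supp_map φ z).trans hz) = map φ (lift s A z hz) := by
  rw [lift, lift]
  split_ifs
  · rfl
  · exact push_map φ A z hz
  · rfl

/-- The label `A` may vary arbitrarily with the point because no open set sees it. At time `1/2` a
point moves to `mid`, whose smallest neighbourhood contains both its old position and `top`. -/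
lemma continuous_lift {X : Type*} [TopologicalSpace X] {f : X → Telescope p c d} {s : X → ℝ}
    (hf : Continuous f) (hs : Continuous s) (A : X → Label c) (hA : ∀ x, (f x).supp ⊆ (A x).1) :
    Continuous fun x ↦ lift (s x) (A x) (f x) (hA x) := by
  rw [continuous_iff] at hf ⊢
  have h₀ : IsOpen { x | s x < 1 / 2 } := isOpen_lt hs continuous_const
  have h₁ : IsOpen { x | 1 / 2 < s x } := isOpen_lt continuous_const hs
  have key : ∀ x, (s x < 1 / 2 ∧ lift (s x) (A x) (f x) (hA x) = f x) ∨
      (s x = 1 / 2 ∧ lift (s x) (A x) (f x) (hA x) = push (A x) (f x) (hA x)) ∨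
      (1 / 2 < s x ∧ lift (s x) (A x) (f x) (hA x) = top) := fun x ↦ by
    obtain h | h | h := lt_trichotomy (s x) (1 / 2)
    · exact Or.inl ⟨h, if_pos h⟩
    · exact Or.inr (Or.inl ⟨h, (if_neg h.not_lt).trans (if_pos h)⟩)
    · exact Or.inr (Or.inr ⟨h, (if_neg h.not_gt).trans (if_neg h.ne')⟩)
  refine ⟨fun w ↦ ?_, ?_, fun w ↦ ?_⟩
  · convert h₀.inter (hf.1 w)
    ext x
    simp only [Set.mem_ofPred_eq, Set.mem_inter_iff]
    obtain ⟨h, e⟩ | ⟨h, e⟩ | ⟨h, e⟩ := key x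
    · rw [e, and_iff_right h]
    · rw [e]
      exact iff_of_false (push_ne_bot _ _ _ _) fun h' ↦ h'.1.ne h
    · rw [e]
      exact iff_of_false nofun fun h' ↦ lt_asymm h h'.1
  · convert h₁.union hf.2.1
    ext x
    simp only [Set.mem_ofPred_eq, Set.mem_union]
    obtain ⟨h, e⟩ | ⟨h, e⟩ | ⟨h, e⟩ := key x
    · rw [e, or_iff_right h.not_gt]
    · rw [e, push_eq_top, or_iff_right h.not_gt]
    · rw [e]
      exact iff_of_true rfl (Or.inl h)
  · convert h₁.union (hf.2.2 w)
    ext x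
    simp only [Set.mem_ofPred_eq, Set.mem_union]
    obtain ⟨h, e⟩ | ⟨h, e⟩ | ⟨h, e⟩ := key x
    · rw [e, or_iff_right h.not_gt]
    · rw [e, push_mem_star, or_iff_right h.not_gt]
    · rw [e]
      exact iff_of_true (Or.inr (Or.inl rfl)) (Or.inl h)

end Telescope

/-- The diagram of telescopes. -/
def telescope : D ⥤ TopCat.{u} where
  obj d := TopCat.of (Telescope p c d)
  map φ := TopCat.ofHom ⟨Telescope.map φ, Telescope.continuous_map φ⟩
  map_id d := by
    ext z
    cases z with
    | bot w => exact congrArg Telescope.bot (Functor.map_id_apply (wedge p (BigIndex c)) d w)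
    | mid w A h =>
      change Telescope.mid _ _ _ = Telescope.mid _ _ _
      congr 1
      exact Functor.map_id_apply (wedge p (BigIndex c)) d w
    | top => rfl
  map_comp φ ψ := by
    ext z
    cases z with
    | bot w => exact congrArg Telescope.bot (Functor.map_comp_apply (wedge p (BigIndex c)) φ ψ w)
    | mid w A h =>
      change Telescope.mid _ _ _ = Telescope.mid _ _ _
      congr 1
      exact Functor.map_comp_apply (wedge p (BigIndex c)) φ ψ w
    | top => rfl

end Telescope

end SpaceDiagram

end

/-! ### Maps into the telescope -/

section

open Opposite Simplicial

namespace SpaceDiagram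

variable {D : Type u} [SmallCategory D]

section TelescopeComplex

variable {t : D ⥤ Type u} {p : PointOf t} {c : Cardinal.{u}} {T : D ⥤ TopCat.{u}}

/-- The map to the top of the telescope. -/
def topFamily (p : PointOf t) (c : Cardinal.{u}) (T : D ⥤ TopCat.{u}) (n : SimplexCategory) :
    ContinuousFamily T (telescope p c) n where
  toFun _ _ _ := Telescope.top
  continuous_toFun _ := continuous_const
  toFun_map _ _ _ := rfl

lemma exists_bound_telescope (hT : Cardinal.mk (Σ d, T.obj d) ≤ c)
    (g : ∀ d, T.obj d → Telescope p c d) :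
    ∃ A : Label c, ∀ d x, (g d x).supp ⊆ A.1 := by
  obtain ⟨A, hA⟩ := Label.exists_bound hT (fun x ↦ (g x.1 x.2).supp)
    fun x ↦ Telescope.supp_subsingleton _
  exact ⟨A, fun d x ↦ hA ⟨d, x⟩⟩

/-- A label bounding the supports of a family of points of the telescope. -/
noncomputable def boundLabel (hT : Cardinal.mk (Σ d, T.obj d) ≤ c)
    (g : ∀ d, T.obj d → Telescope p c d) : Label c :=
  (exists_bound_telescope hT g).choose

lemma supp_subset_boundLabel (hT : Cardinal.mk (Σ d, T.obj d) ≤ c)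
    (g : ∀ d, T.obj d → Telescope p c d) (d : D) (x : T.obj d) :
    (g d x).supp ⊆ (boundLabel hT g).1 :=
  (exists_bound_telescope hT g).choose_spec d x

/-- The values of a map to the telescope at a point of the simplex. -/
def valuesAt {n : SimplexCategory} (φ : ContinuousFamily T (telescope p c) n) (x : geomSimplex n)
    (d : D) (y : T.obj d) : Telescope p c d :=
  φ.toFun d x y

/-- The contraction of the complex of maps to the telescope. -/
noncomputable def liftFamily (hT : Cardinal.mk (Σ d, T.obj d) ≤ c) {n : SimplexCategory}
    (φ : ContinuousFamily T (telescope p c) n) (σ : n ⟶ ⦋1⦌) :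
    ContinuousFamily T (telescope p c) n where
  -- The label is chosen from all values at `x` at once: being independent of `d` and `y` it
  -- respects `D`, and depending on nothing but these values it respects the simplicial structure.
  -- Time is the coordinate at vertex `0`, so that vertex corresponds to `top`.
  toFun d x y := Telescope.lift (geomMap σ x 0) (boundLabel hT (valuesAt φ x))
    (valuesAt φ x d y) (supp_subset_boundLabel hT _ d y)
  continuous_toFun d := Telescope.continuous_lift (φ.continuous_toFun d)
    ((continuous_coord 0).comp ((stdSimplex.continuous_map σ).comp continuous_fst)) _ _
  toFun_map {d d'} f x y := by
    refine Eq.trans ?_ (Telescope.lift_map f (geomMap σ x 0) (boundLabel hT (valuesAt φ x))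
      (valuesAt φ x d y) (supp_subset_boundLabel hT _ d y))
    congr 1
    exact φ.toFun_map f x y

lemma isContractible_continuousComplex_telescope (hT : Cardinal.mk (Σ d, T.obj d) ≤ c) :
    (continuousComplex T (telescope p c)).IsContractible := by
  refine SSet.isContractible_of_contraction (topFamily p c T ⦋0⦌) (fun n φ σ ↦ liftFamily hT φ σ)
    (fun {n m} θ φ σ ↦ ?_) (fun n φ ↦ ?_) (fun n φ ↦ ?_)
  · refine ContinuousFamily.ext (funext fun d ↦ funext fun x ↦ funext fun y ↦ ?_)
    change Telescope.lift (geomMap σ (geomMap θ.unop x) 0) _ _ _ =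
      Telescope.lift (geomMap (θ.unop ≫ σ) x 0) _ _ _
    rw [geomMap_comp]
    rfl
  · refine ContinuousFamily.ext (funext fun d ↦ funext fun x ↦ funext fun y ↦ ?_)
    have h : geomMap (SimplexCategory.const n.unop ⦋1⦌ 0) x 0 = 1 := by
      rw [geomMap_apply]
      exact (Finset.sum_congr rfl fun i _ ↦ if_pos rfl).trans (stdSimplex.sum_eq_one x)
    change Telescope.lift (geomMap (SimplexCategory.const n.unop ⦋1⦌ 0) x 0) _ _ _ = Telescope.top
    simp only [h, Telescope.lift_one]
  · refine ContinuousFamily.ext (funext fun d ↦ funext fun x ↦ funext fun y ↦ ?_)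
    have h : geomMap (SimplexCategory.const n.unop ⦋1⦌ 1) x 0 = 0 :=
      geomMap_apply_eq_zero _ _ _ fun i ↦ one_ne_zero
    change Telescope.lift (geomMap (SimplexCategory.const n.unop ⦋1⦌ 1) x 0) _ _ _ = φ.toFun d x y
    simp only [h, Telescope.lift_zero]
    rfl

end TelescopeComplex

section NotConnected

variable {t : D ⥤ Type u} {p : PointOf t} {c : Cardinal.{u}} {X : D ⥤ TopCat.{u}}
  (g : ∀ d, X.obj d → Wedge p (BigIndex c) d)

/-- A point of the geometric simplex at which a map agrees with a given map to the bottom. -/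
def IsBotAt {n : SimplexCategory} (φ : ContinuousFamily X (telescope p c) n) (x : geomSimplex n) :
    Prop :=
  ∀ d y, valuesAt φ x d y = Telescope.bot (g d y)

variable {g}

lemma continuous_valuesAt {n : SimplexCategory} (φ : ContinuousFamily X (telescope p c) n) (d : D)
    (y : X.obj d) : Continuous fun x ↦ valuesAt φ x d y :=
  (φ.continuous_toFun d).comp (continuous_id.prodMk continuous_const)

/-- Height and label are preserved by the maps of `D`, so they form a cocone under a connected
diagram. -/
lemma level_valuesAt (hX : IsConnectedDiagram (X ⋙ forget TopCat)) {n : SimplexCategory}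
    (φ : ContinuousFamily X (telescope p c) n) (x : geomSimplex n) (d d' : D) (y : X.obj d)
    (y' : X.obj d') : (valuesAt φ x d y).level = (valuesAt φ x d' y').level :=
  hX (fun d y ↦ (valuesAt φ x d y).level) (fun _ _ f y ↦
    (congrArg Telescope.level (φ.toFun_map f x y)).trans (Telescope.level_map f _)) d d' y y'

/-- In the limit a value `bot (g d y)` could only rise to some `mid (g d y) A`. Then all values
would have level `mid` with the same `A`, which would contain every support of `g`, against `hg`. -/
lemma isClosed_setOf_isBotAt (hX : IsConnectedDiagram (X ⋙ forget TopCat))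
    (hg : ∀ A : Label c, ∃ d y, ¬ (g d y).supp ⊆ A.1) {n : SimplexCategory}
    (φ : ContinuousFamily X (telescope p c) n) : IsClosed { x | IsBotAt g φ x } := by
  let S (d : D) (w : Wedge p (BigIndex c) d) : Set (Telescope p c d) :=
    { z | z = Telescope.bot w ∨ ∃ A h, z = Telescope.mid w A h }
  have hS : ∀ d w, IsClosed (S d w) := fun d w ↦ by
    rw [← isOpen_compl_iff]
    intro w' A h hw
    have hw' : w' ≠ w := by
      rintro rfl
      exact hw (Or.inr ⟨A, h, rfl⟩)
    refine ⟨?_, ?_, fun A' h' ↦ ?_⟩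
    · rintro (h | ⟨A, h, e⟩)
      · cases h
        exact hw' rfl
      · cases e
    · rintro (h | ⟨A, h, e⟩)
      · cases h
      · cases e
    · rintro (h | ⟨A, h, e⟩)
      · cases h
      · cases e
        exact hw' rfl
  have e : { x | IsBotAt g φ x } = ⋂ (d) (y), { x | valuesAt φ x d y ∈ S d (g d y) } := by
    ext x
    simp only [Set.mem_iInter]
    refine ⟨fun h d y ↦ Or.inl (h d y), fun h ↦ ?_⟩
    by_contra hx
    obtain ⟨d, y, hdy⟩ : ∃ d y, valuesAt φ x d y ≠ Telescope.bot (g d y) := by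
      by_contra! h'
      exact hx h'
    obtain h' | ⟨A, hA, h'⟩ := h d y
    · exact hdy h'
    · obtain ⟨d', y', hA'⟩ := hg A
      have hl := level_valuesAt hX φ x d d' y y'
      rw [h'] at hl
      obtain h'' | ⟨A', hA'', h''⟩ := h d' y'
      · rw [h''] at hl
        cases hl
      · rw [h''] at hl
        cases hl
        exact hA' hA''
  rw [e]
  exact isClosed_iInter fun d ↦ isClosed_iInter fun y ↦
    (hS d (g d y)).preimage (continuous_valuesAt φ d y)

/-- One value at the bottom puts all values there, since the level is common; the bottom is
discrete, so each value is constant on `V`. -/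
lemma isBotAt_of_isPreconnected (hX : IsConnectedDiagram (X ⋙ forget TopCat))
    {n : SimplexCategory} (φ : ContinuousFamily X (telescope p c) n) {V : Set (geomSimplex n)}
    (hV : _root_.IsPreconnected V) {d₀ : D} {y₀ : X.obj d₀}
    (hV' : ∀ x ∈ V, ∃ w, valuesAt φ x d₀ y₀ = Telescope.bot w) {x x' : geomSimplex n} (hx : x ∈ V)
    (hx' : x' ∈ V) (h : IsBotAt g φ x) : IsBotAt g φ x' := by
  intro d y
  have hbot : ∀ x ∈ V, ∃ w, valuesAt φ x d y = Telescope.bot w := fun x hx ↦ by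
    obtain ⟨w, hw⟩ := hV' x hx
    have hl := level_valuesAt hX φ x d d₀ y y₀
    rw [hw] at hl
    revert hl
    cases valuesAt φ x d y with
    | bot w' => exact fun _ ↦ ⟨w', rfl⟩
    | mid => exact nofun
    | top => exact nofun
  have hsub := hV.subset_left_of_subset_union
    ((Telescope.isOpen_bot {g d y}).preimage (continuous_valuesAt φ d y))
    ((Telescope.isOpen_bot {g d y}ᶜ).preimage (continuous_valuesAt φ d y))
    (Set.disjoint_left.2 ?_) (fun z hz ↦ ?_) ⟨x, hx, _, rfl, (h d y).symm⟩
  · obtain ⟨w, rfl, hw⟩ := hsub hx'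
    exact hw.symm
  · rintro z ⟨w, rfl, hw⟩ ⟨w', hw', hw''⟩
    rw [← hw] at hw''
    cases hw''
    exact hw' rfl
  · obtain ⟨w, hw⟩ := hbot z hz
    by_cases h : w = g d y
    · exact Or.inl ⟨w, h, hw.symm⟩
    · exact Or.inr ⟨w, h, hw.symm⟩

/-- The path which runs through a geometric `1`-simplex. -/
noncomputable def geomPath (s : ℝ) : geomSimplex ⦋1⦌ :=
  stdSimplexHomeomorphUnitInterval.symm (Set.projIcc 0 1 zero_le_one s)

lemma continuous_geomPath : Continuous geomPath :=
  stdSimplexHomeomorphUnitInterval.symm.continuous.comp continuous_projIcc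

lemma surjective_geomPath : Function.Surjective geomPath :=
  stdSimplexHomeomorphUnitInterval.symm.surjective.comp (Set.projIcc_surjective zero_le_one)

/-- The condition is closed, and open because being at the bottom for one element persists on a
connected neighbourhood. No common neighbourhood for all `y` has to be found. Pulling back to `ℝ`
provides connectedness and local connectedness. -/
lemma isBotAt_iff (hX : IsConnectedDiagram (X ⋙ forget TopCat))
    (hg : ∀ A : Label c, ∃ d y, ¬ (g d y).supp ⊆ A.1)
    (φ : ContinuousFamily X (telescope p c) ⦋1⦌) (x x' : geomSimplex ⦋1⦌) :
    IsBotAt g φ x ↔ IsBotAt g φ x' := by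
  have hclosed := (isClosed_setOf_isBotAt hX hg φ).preimage continuous_geomPath
  have hopen : IsOpen (geomPath ⁻¹' { x | IsBotAt g φ x }) := by
    rw [isOpen_iff_mem_nhds]
    intro s hs
    obtain ⟨d₀, y₀, -⟩ := hg default
    have hO : IsOpen { s | valuesAt φ (geomPath s) d₀ y₀ ∈
        (Telescope.bot '' Set.univ : Set (Telescope p c d₀)) } :=
      (Telescope.isOpen_bot Set.univ).preimage ((continuous_valuesAt φ d₀ y₀).comp
        continuous_geomPath)
    obtain ⟨V, hV, hVo, hsV, hVc⟩ := locallyConnectedSpace_iff_subsets_isOpen_isConnected.1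
      (inferInstanceAs (LocallyConnectedSpace ℝ)) s _ (hO.mem_nhds ⟨g d₀ y₀, trivial, (hs d₀ y₀).symm⟩)
    refine Filter.mem_of_superset (hVo.mem_nhds hsV) fun s' hs' ↦ ?_
    refine isBotAt_of_isPreconnected hX φ (hVc.isPreconnected.image _
      continuous_geomPath.continuousOn) (d₀ := d₀) (y₀ := y₀) ?_ ⟨s, hsV, rfl⟩ ⟨s', hs', rfl⟩ hs
    rintro _ ⟨r, hr, rfl⟩
    obtain ⟨w, -, hw⟩ := hV hr
    exact ⟨w, hw.symm⟩
  obtain ⟨s, rfl⟩ := surjective_geomPath x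
  obtain ⟨s', rfl⟩ := surjective_geomPath x'
  obtain h | h := isClopen_iff.1 (⟨hclosed, hopen⟩ : IsClopen (geomPath ⁻¹' { x | IsBotAt g φ x }))
  · exact iff_of_false (fun hs ↦ (Set.eq_empty_iff_forall_notMem.1 h s) hs)
      (fun hs ↦ (Set.eq_empty_iff_forall_notMem.1 h s') hs)
  · exact iff_of_true (Set.eq_univ_iff_forall.1 h s) (Set.eq_univ_iff_forall.1 h s')

/-- The map to the bottom of the telescope. -/
def botFamily (g : ∀ d, X.obj d → Wedge p (BigIndex c) d)
    (hg : ∀ {d d'} (f : d ⟶ d') y, g d' (X.map f y) = (wedge p (BigIndex c)).map f (g d y))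
    (hX : ∀ d, DiscreteTopology (X.obj d)) (n : SimplexCategory) :
    ContinuousFamily X (telescope p c) n where
  toFun d _ y := Telescope.bot (g d y)
  continuous_toFun d := by
    have := hX d
    exact (continuous_of_discreteTopology (f := fun y ↦ Telescope.bot (g d y))).comp continuous_snd
  toFun_map f _ y := congrArg Telescope.bot (hg f y)

lemma exists_hom_constant_ne (hX : IsConnectedDiagram (X ⋙ forget TopCat))
    (hX' : ∀ d, DiscreteTopology (X.obj d)) (g : ∀ d, X.obj d → Wedge p (BigIndex c) d)
    (hg : ∀ {d d'} (f : d ⟶ d') y, g d' (X.map f y) = (wedge p (BigIndex c)).map f (g d y))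
    (hg' : ∀ A : Label c, ∃ d y, ¬ (g d y).supp ⊆ A.1) :
    ∃ (a : continuousComplex X (telescope p c) ⟶ SSet.constant (ULift.{u} Prop))
      (x y : (continuousComplex X (telescope p c)) _⦋0⦌),
      (a.app _ x : ULift.{u} Prop) ≠ a.app _ y := by
  let P (φ : ContinuousFamily X (telescope p c) ⦋0⦌) : Prop := ∀ x, IsBotAt g φ x
  have hP : ∀ e : (continuousComplex X (telescope p c)) _⦋1⦌,
      P ((continuousComplex X (telescope p c)).map (SimplexCategory.δ 1).op e) ↔
        P ((continuousComplex X (telescope p c)).map (SimplexCategory.δ 0).op e) := fun e ↦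
    ⟨fun h x ↦ (isBotAt_iff hX hg' e _ _).1 (h x), fun h x ↦ (isBotAt_iff hX hg' e _ _).1 (h x)⟩
  refine ⟨SSet.toConstantOfEdges (L := continuousComplex X (telescope p c)) P hP,
    botFamily g hg hX' ⦋0⦌, topFamily p c X ⦋0⦌, fun h ↦ ?_⟩
  have e := ((SSet.toConstantOfEdges_app_zero (L := continuousComplex X (telescope p c)) P hP
    _).symm.trans h).trans (SSet.toConstantOfEdges_app_zero
      (L := continuousComplex X (telescope p c)) P hP _)
  have h' := (congrArg ULift.down e).mp fun _ _ _ ↦ rfl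
  obtain ⟨d, y, -⟩ := hg' default
  have := h' default d y
  cases this

end NotConnected

end SpaceDiagram

end

/-! ### Alexandrov-discrete spaces in the topological categories -/

section

open Opposite Simplicial

/-- Openness in an Alexandrov-discrete space means stability under generization. If `x` specializes
to `y`, the path equal to `y` up to time `0` and to `x` afterwards is continuous, so paths detect
it. -/
lemma deltaGeneratedSpace_of_alexandrovDiscrete (X : Type*) [TopologicalSpace X]
    [AlexandrovDiscrete X] : DeltaGeneratedSpace X := by
  suffices key : ∀ U : Set X, (∀ ⦃i⦄ (f : C(Fin i → ℝ, X)), IsOpen (f ⁻¹' U)) → IsOpen U from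
    ⟨continuous_def.2 fun U hU ↦ key _ (Topology.WithGeneratedByTopology.isOpen_iff.1 hU)⟩
  intro U hU
  rw [isOpen_iff_forall_specializes]
  intro x y hxy hy
  classical
  let f : C(Fin 1 → ℝ, X) :=
    { toFun := fun s ↦ if 0 < s 0 then x else y
      continuous_toFun := by
        rw [continuous_def]
        intro V hV
        by_cases hyV : y ∈ V
        · convert isOpen_univ
          refine Set.eq_univ_of_forall fun s ↦ ?_
          change (if _ then _ else _) ∈ V
          split_ifs
          · exact hxy.mem_open hV hyV
          · exact hyV
        · by_cases hxV : x ∈ V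
          · convert isOpen_lt (continuous_const (y := (0 : ℝ)))
              (show Continuous fun s : Fin 1 → ℝ ↦ s 0 by fun_prop)
            ext s
            change (if _ then _ else _) ∈ V ↔ 0 < s 0
            split_ifs with h
            · exact iff_of_true hxV h
            · exact iff_of_false hyV h
          · convert isOpen_empty
            refine Set.eq_empty_of_forall_notMem fun s ↦ ?_
            change (if _ then _ else _) ∉ V
            split_ifs <;> assumption }
  have h₀ : f (fun _ ↦ 0) ∈ U := by
    change (if _ then _ else _) ∈ _
    rwa [if_neg (lt_irrefl _)]
  have hc : Continuous fun (r : ℝ) (_ : Fin 1) ↦ r := by fun_prop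
  obtain ⟨ε, hε, h⟩ := Metric.isOpen_iff.1 ((hU f).preimage hc) 0 h₀
  have h₁ : f (fun _ ↦ ε / 2) ∈ U := h (by
    rw [Metric.mem_ball, Real.dist_eq, sub_zero, abs_of_pos (half_pos hε)]
    exact half_lt_self hε)
  change (if _ then _ else _) ∈ _ at h₁
  rwa [if_pos (half_pos hε)] at h₁

namespace SpaceDiagram

variable {D : Type u} [SmallCategory D]

/-- Maps to a diagram of indiscrete spaces form a contractible complex if there are any. -/
lemma isContractible_continuousComplex_trivial {F : D ⥤ Type u} {T : D ⥤ TopCat.{u}}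
    (v : ∀ d, T.obj d → F.obj d)
    (hv : ∀ {d d'} (f : d ⟶ d') y, v d' (T.map f y) = F.map f (v d y)) :
    (continuousComplex T (F ⋙ TopCat.trivial)).IsContractible := by
  classical
  refine SSet.isContractible_of_contraction
    { toFun := fun d _ y ↦ v d y
      continuous_toFun := fun d ↦ continuous_top
      toFun_map := fun f _ y ↦ hv f y }
    (fun n φ σ ↦
      { toFun := fun d x y ↦ if geomMap σ x 0 = 0 then φ.toFun d x y else v d y
        continuous_toFun := fun d ↦ continuous_top
        toFun_map := fun f x y ↦ by
          by_cases hx : geomMap σ x 0 = 0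
          · exact (if_pos hx).trans ((φ.toFun_map f x y).trans (congrArg _ (if_pos hx).symm))
          · exact (if_neg hx).trans ((hv f y).trans (congrArg (F.map f) (if_neg hx).symm)) })
    (fun {n m} θ φ σ ↦ ?_) (fun n φ ↦ ?_) (fun n φ ↦ ?_)
  · refine ContinuousFamily.ext (funext fun d ↦ funext fun x ↦ funext fun y ↦ ?_)
    change (if geomMap σ (geomMap θ.unop x) 0 = 0 then _ else _) =
      if geomMap (θ.unop ≫ σ) x 0 = 0 then _ else _
    rw [geomMap_comp]
    rfl
  · refine ContinuousFamily.ext (funext fun d ↦ funext fun x ↦ funext fun y ↦ ?_)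
    have h : geomMap (SimplexCategory.const n.unop ⦋1⦌ 0) x 0 = 1 := by
      rw [geomMap_apply]
      exact (Finset.sum_congr rfl fun i _ ↦ if_pos rfl).trans (stdSimplex.sum_eq_one x)
    exact if_neg (h.trans_ne one_ne_zero)
  · refine ContinuousFamily.ext (funext fun d ↦ funext fun x ↦ funext fun y ↦ ?_)
    exact if_pos (geomMap_apply_eq_zero _ _ _ fun i ↦ one_ne_zero)

section TopologicalSpaces

variable {𝒮 : Type (u + 1)} [LargeCategory.{u} 𝒮]

/-- Simplicial function complexes in a category of topological spaces. -/
noncomputable abbrev topSpaceCategory (ι : 𝒮 ⥤ TopCat.{u}) : SpaceCategory.{u} 𝒮 where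
  Amb := TopCat.{u}
  incl := ι
  simplexProd := SimplexCategory.toTop.{u} ⋙ curriedTensor TopCat.{u} ⋙
    (Functor.whiskeringLeft _ _ _).obj ι

/-- A full category of topological spaces containing all Alexandrov-discrete spaces. -/
structure TopSpaces (ι : 𝒮 ⥤ TopCat.{u}) where
  /-- The inclusion in topological spaces is fully faithful. -/
  fullyFaithful : ι.FullyFaithful
  /-- The object corresponding to an Alexandrov-discrete space. -/
  of (X : TopCat.{u}) [AlexandrovDiscrete X] : 𝒮
  /-- The underlying space of `of X` is `X`. -/
  iso (X : TopCat.{u}) [AlexandrovDiscrete X] : ι.obj (of X) ≅ X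

namespace TopSpaces

variable {ι : 𝒮 ⥤ TopCat.{u}} (h : TopSpaces ι)

/-- A diagram of Alexandrov-discrete spaces as a diagram in the category of spaces. -/
def diagram (Y : D ⥤ TopCat.{u}) [∀ d, AlexandrovDiscrete (Y.obj d)] : D ⥤ 𝒮 where
  obj d := h.of (Y.obj d)
  map {d d'} f := h.fullyFaithful.preimage ((h.iso (Y.obj d)).hom ≫ Y.map f ≫ (h.iso (Y.obj d')).inv)
  map_id d := h.fullyFaithful.map_injective (by simp)
  map_comp f g := h.fullyFaithful.map_injective (by simp)

/-- The underlying diagram of spaces of `h.diagram Y` is `Y`. -/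
def diagramIso (Y : D ⥤ TopCat.{u}) [∀ d, AlexandrovDiscrete (Y.obj d)] : h.diagram Y ⋙ ι ≅ Y :=
  NatIso.ofComponents (fun d ↦ h.iso (Y.obj d)) (fun f ↦ by simp [diagram])

/-- `of ∅` is initial. -/
def isInitialOf : IsInitial (h.of (TopCat.of PEmpty)) :=
  IsInitial.ofUniqueHom (fun X ↦ h.fullyFaithful.preimage
      ((h.iso _).hom ≫ TopCat.isInitialPEmpty.to (ι.obj X)))
    (fun _ _ ↦ h.fullyFaithful.map_injective
      ((TopCat.isInitialPEmpty.ofIso (h.iso (TopCat.of PEmpty)).symm).hom_ext _ _))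

/-- The underlying space of the point is terminal. -/
def isTerminalObjOf : IsTerminal (ι.obj (h.of (TopCat.of PUnit))) :=
  TopCat.isTerminalPUnit.ofIso (h.iso (TopCat.of PUnit)).symm

/-- The point is terminal. -/
def isTerminalOf : IsTerminal (h.of (TopCat.of PUnit)) :=
  IsTerminal.ofUniqueHom (fun X ↦ h.fullyFaithful.preimage (h.isTerminalObjOf.from (ι.obj X)))
    (fun _ _ ↦ h.fullyFaithful.map_injective (h.isTerminalObjOf.hom_ext _ _))

/-- `Δ^0 × X` is `X`. -/
noncomputable def zeroIso (X : TopCat.{u}) : SimplexCategory.toTop.{u}.obj ⦋0⦌ ⊗ X ≅ X :=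
  whiskerRightIso (show SimplexCategory.toTop.{u}.obj ⦋0⦌ ≅ 𝟙_ TopCat.{u} from
    TopCat.isoOfHomeo (Y := TopCat.of PUnit) (Homeomorph.homeomorphOfUnique _ PUnit)) X ≪≫ λ_ X

/-- Full categories of topological spaces are categories of spaces. -/
noncomputable def spaceProperties : @SpaceProperties 𝒮 _ (topSpaceCategory ι) :=
  letI := topSpaceCategory ι
  { fullyFaithful := h.fullyFaithful
    zeroIso := NatIso.ofComponents (fun X ↦ zeroIso (ι.obj X)) (fun f ↦ by
      refine TopCat.ext fun x ↦ rfl)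
    empty := h.of (TopCat.of PEmpty)
    isInitialEmpty := h.isInitialOf
    point := h.of (TopCat.of PUnit)
    isTerminalPoint := h.isTerminalOf
    isTerminalInclPoint := h.isTerminalObjOf }

/-- A simplex of the function complex as a family of continuous maps. -/
noncomputable def toContinuousFamily {T Y : D ⥤ TopCat.{u}} {n : SimplexCategory}
    (φ : T ⋙ (curriedTensor TopCat.{u}).obj (SimplexCategory.toTop.{u}.obj n) ⟶ Y) :
    ContinuousFamily T Y n where
  toFun d x t := φ.app d (⟨x⟩, t)
  continuous_toFun d := (φ.app d).hom.continuous.comp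
    ((continuous_uliftUp.comp continuous_fst).prodMk continuous_snd)
  toFun_map f x t := NatTrans.naturality_apply φ f (⟨x⟩, t)

/-- A family of continuous maps as a simplex of the function complex. -/
noncomputable def ofContinuousFamily {T Y : D ⥤ TopCat.{u}} {n : SimplexCategory} (φ : ContinuousFamily T Y n) :
    T ⋙ (curriedTensor TopCat.{u}).obj (SimplexCategory.toTop.{u}.obj n) ⟶ Y where
  app d := TopCat.ofHom ⟨fun x ↦ φ.toFun d x.1.down x.2, (φ.continuous_toFun d).comp
    ((continuous_uliftDown.comp continuous_fst).prodMk continuous_snd)⟩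
  naturality _ _ f := TopCat.ext fun _ ↦ φ.toFun_map f _ _

/-- The comparison of the two definitions of function complexes. -/
noncomputable def mapComplexIsoContinuousComplex (T : D ⥤ 𝒮) (Y : D ⥤ TopCat.{u}) :
    @mapComplex D _ 𝒮 _ (topSpaceCategory ι) T Y ≅ continuousComplex (T ⋙ ι) Y where
  hom := { app := fun _ ↦ ↾fun φ ↦ toContinuousFamily (T := T ⋙ ι) φ
           naturality := fun _ _ _ ↦ rfl }
  inv := { app := fun _ ↦ ↾fun φ ↦ ofContinuousFamily (T := T ⋙ ι) φ
           naturality := fun _ _ _ ↦ rfl }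
  hom_inv_id := rfl
  inv_hom_id := rfl

end TopSpaces

end TopologicalSpaces

end SpaceDiagram

end

/-! ### Regular orbits of topological spaces -/

section

open Opposite Simplicial

namespace SpaceDiagram

instance (Q : Type u) : AlexandrovDiscrete (TopCat.trivial.obj Q) :=
  haveI : IndiscreteTopology (TopCat.trivial.obj Q) := ⟨rfl⟩
  inferInstance

instance (Q : Type u) : DiscreteTopology (TopCat.discrete.obj Q) := ⟨rfl⟩

variable {D : Type u} [SmallCategory D] {𝒮 : Type (u + 1)} [LargeCategory.{u} 𝒮]

instance (F : D ⥤ Type u) (d : D) : AlexandrovDiscrete ((F ⋙ TopCat.trivial).obj d) :=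
  inferInstanceAs (AlexandrovDiscrete (TopCat.trivial.obj _))

instance (F : D ⥤ Type u) (d : D) : DiscreteTopology ((F ⋙ TopCat.discrete).obj d) :=
  inferInstanceAs (DiscreteTopology (TopCat.discrete.obj _))

instance {t : D ⥤ Type u} (p : PointOf t) (c : Cardinal.{u}) (d : D) :
    AlexandrovDiscrete ((telescope p c).obj d) :=
  inferInstanceAs (AlexandrovDiscrete (Telescope p c d))

namespace TopSpaces

variable {ι : 𝒮 ⥤ TopCat.{u}} (h : TopSpaces ι)

section
include h

lemma subsingleton_of_isTerminal {X : 𝒮} (hX : IsTerminal X) : Subsingleton (ι.obj X) := by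
  let e := ι.mapIso (hX.uniqueUpToIso h.isTerminalOf) ≪≫ h.iso (TopCat.of PUnit)
  refine ⟨fun x y ↦ ?_⟩
  rw [← TopCat.hom_inv_id_apply e x, ← TopCat.hom_inv_id_apply e y]

/-- With the indiscrete topology on `Q`, any cocone of sets becomes a cocone in `𝒮` and factors
through the point. Colimits in `𝒮` need not be compared with those of `TopCat`. -/
lemma isConnectedDiagram_of_isOrbit {T : D ⥤ 𝒮} (hT : IsOrbit T) :
    IsConnectedDiagram ((T ⋙ ι) ⋙ forget TopCat.{u}) := by
  obtain ⟨c, ⟨hc⟩, ⟨hc'⟩⟩ := hT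
  intro Q g hg d d' x x'
  let g' (d : D) : ι.obj (T.obj d) ⟶ TopCat.trivial.obj Q :=
    TopCat.ofHom (Y := TopCat.trivial.obj Q) ⟨g d, continuous_top⟩
  let s : Cocone T :=
    { pt := h.of (TopCat.trivial.obj Q)
      ι := { app := fun d ↦ h.fullyFaithful.preimage (g' d ≫ (h.iso _).inv)
             naturality := fun d d' f ↦ h.fullyFaithful.map_injective (by
              have : ι.map (T.map f) ≫ g' d' = g' d := TopCat.ext fun x ↦ hg f x
              simp [reassoc_of% this]) } }
  let q := ι.map (hc.desc s) ≫ (h.iso (TopCat.trivial.obj Q)).hom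
  have hq : ∀ d, ι.map (c.ι.app d) ≫ q = g' d := fun d ↦ by
    rw [← Functor.map_comp_assoc, hc.fac]
    simp [s]
  have := h.subsingleton_of_isTerminal hc'
  have e : ∀ d x, q (ι.map (c.ι.app d) x) = g d x := fun d x ↦ ConcreteCategory.congr_hom (hq d) x
  rw [← e, ← e]
  exact congrArg q (Subsingleton.elim _ _)

lemma nonempty_of_isOrbit {T : D ⥤ 𝒮} (hT : IsOrbit T) : Nonempty D := by
  obtain ⟨c, ⟨hc⟩, ⟨hc'⟩⟩ := hT
  by_contra hD
  rw [not_nonempty_iff] at hD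
  let s : Cocone T :=
    { pt := h.of (TopCat.of PEmpty)
      ι := { app := fun d ↦ hD.elim d
             naturality := fun d ↦ hD.elim d } }
  let q := (h.iso (TopCat.of PUnit)).inv ≫ ι.map (hc'.from _ ≫ hc.desc s) ≫
    (h.iso (TopCat.of PEmpty)).hom
  exact PEmpty.elim (q PUnit.unit)

lemma exists_pointOf {T : D ⥤ 𝒮} (hT : IsRegularOrbit T) :
    Nonempty (PointOf ((T ⋙ ι) ⋙ forget TopCat.{u})) := by
  obtain ⟨-, P, ⟨hP⟩, ⟨f⟩⟩ := hT
  let q : (Functor.const D).obj (h.of (TopCat.of PUnit)) ⟶ T := hP.from _ ≫ f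
  let x : ι.obj (h.of (TopCat.of PUnit)) := (h.iso (TopCat.of PUnit)).inv PUnit.unit
  refine ⟨{ pt := fun d ↦ ι.map (q.app d) x, map_pt := fun d d' f ↦ ?_ }⟩
  have e : ι.map (q.app d) ≫ ι.map (T.map f) = ι.map (q.app d') := by
    rw [← Functor.map_comp, ← q.naturality]
    simp
  exact ConcreteCategory.congr_hom e x

lemma isOrbit_discrete {W : D ⥤ Type u} (hW : IsConnectedDiagram W) (p : PointOf W) (d₀ : D) :
    IsOrbit (h.diagram (W ⋙ TopCat.discrete)) := by
  let U := h.diagram (W ⋙ TopCat.discrete)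
  let e := h.diagramIso (W ⋙ TopCat.discrete)
  refine ⟨{ pt := h.of (TopCat.of PUnit)
            ι := { app := fun d ↦ h.isTerminalOf.from _
                   naturality := fun _ _ _ ↦ h.isTerminalOf.hom_ext _ _ } }, ⟨?_⟩, ⟨h.isTerminalOf⟩⟩
  let q (s : Cocone U) (d : D) : TopCat.discrete.obj (W.obj d) ⟶ ι.obj s.pt :=
    e.inv.app d ≫ ι.map (s.ι.app d)
  have hq : ∀ (s : Cocone U) ⦃d d'⦄ (f : d ⟶ d'),
      TopCat.discrete.map (W.map f) ≫ q s d' = q s d := fun s d d' f ↦ by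
    have h₁ := e.inv.naturality f
    have h₂ := congrArg ι.map (s.w f)
    rw [Functor.map_comp] at h₂
    change TopCat.discrete.map (W.map f) ≫ e.inv.app d' = e.inv.app d ≫ ι.map (U.map f) at h₁
    rw [← Category.assoc, h₁, Category.assoc, h₂]
  have key : ∀ (s : Cocone U) (d : D) (x : W.obj d), q s d x = q s d₀ (p.pt d₀) := fun s d x ↦
    hW (Q := ι.obj s.pt) (fun d x ↦ q s d x)
      (fun d d' f x ↦ ConcreteCategory.congr_hom (hq s f) x) d d₀ x (p.pt d₀)
  have hx : ∀ d (x : ι.obj (U.obj d)), e.inv.app d (e.hom.app d x) = x := fun d x ↦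
    TopCat.hom_inv_id_apply (e.app d) x
  exact
    { desc := fun s ↦ h.fullyFaithful.preimage (TopCat.const (q s d₀ (p.pt d₀)))
      fac := fun s d ↦ h.fullyFaithful.map_injective (TopCat.ext fun x ↦ by
        rw [Functor.map_comp, Functor.FullyFaithful.map_preimage]
        refine (key s d (e.hom.app d x)).symm.trans ?_
        exact congrArg (ι.map (s.ι.app d)) (hx d x))
      uniq := fun s m hm ↦ h.fullyFaithful.map_injective (TopCat.ext fun x ↦ by
        rw [Functor.FullyFaithful.map_preimage]
        have e₁ := ConcreteCategory.congr_hom ((Functor.map_comp ι _ _).symm.trans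
          (congrArg ι.map (hm d₀))) (e.inv.app d₀ (p.pt d₀))
        refine Eq.trans ?_ e₁
        refine congrArg (ι.map m) ?_
        exact (h.subsingleton_of_isTerminal h.isTerminalOf).elim _ _) }

lemma exists_isWeakEquivalence {B : Set (D ⥤ 𝒮)}
    (hB : letI := topSpaceCategory ι; DetectsContractibility B)
    (Y : D ⥤ TopCat.{u}) [∀ d, AlexandrovDiscrete (Y.obj d)]
    (hY : ∀ b ∈ B, (continuousComplex (b ⋙ ι) Y).IsContractible) {U : D ⥤ 𝒮} (hU : IsOrbit U) :
    Nonempty (U ⋙ ι ⟶ Y) ∧ ∀ {Q : Type u} (a : continuousComplex (U ⋙ ι) Y ⟶ SSet.constant Q)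
      (x y : (continuousComplex (U ⋙ ι) Y) _⦋0⦌), (a.app _ x : Q) = a.app _ y := by
  let _ := topSpaceCategory ι
  have iso (T : D ⥤ 𝒮) : continuousComplex (T ⋙ ι) Y ≅ funComplex T (h.diagram Y) :=
    (mapComplexIsoContinuousComplex T Y).symm ≪≫ mapComplexIso T (h.diagramIso Y).symm
  obtain ⟨⟨f⟩, h₂⟩ := h.spaceProperties.exists_isWeakEquivalence hB (h.diagram Y)
    (fun T _ ↦ (hasHornFilling_continuousComplex _ Y).of_iso (iso T))
    (fun b hb ↦ (hY b hb).of_iso (iso b)) hU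
  refine ⟨⟨Functor.whiskerRight f ι ≫ (h.diagramIso Y).hom⟩, fun a x y ↦ ?_⟩
  have h := h₂ ((iso U).inv ≫ a) ((iso U).hom.app _ x) ((iso U).hom.app _ y)
  have e : (iso U).hom ≫ (iso U).inv ≫ a = a := by simp
  have e' : ∀ z, ((iso U).hom ≫ (iso U).inv ≫ a).app (op ⦋0⦌) z =
      ((iso U).inv ≫ a).app _ ((iso U).hom.app _ z) := fun z ↦ rfl
  rw [← e', ← e', e] at h
  exact h

end

variable {B : Set (D ⥤ 𝒮)} {T : D ⥤ 𝒮}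

section
include h

lemma exists_mem_pointOf [Small.{u} B] (hB : letI := topSpaceCategory ι; DetectsContractibility B)
    (hT : IsRegularOrbit T) : ∃ b ∈ B, Nonempty (PointOf ((b ⋙ ι) ⋙ forget TopCat.{u})) := by
  let F (i : Shrink.{u} B) := (((equivShrink B).symm i).1 ⋙ ι) ⋙ forget TopCat.{u}
  obtain ⟨d₀⟩ := h.nonempty_of_isOrbit hT.1
  obtain ⟨p⟩ := h.exists_pointOf hT
  obtain ⟨⟨f⟩, -⟩ := h.exists_isWeakEquivalence hB (sigmaDiagram F ⋙ TopCat.trivial)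
    (fun b hb ↦ by
      let i := equivShrink B ⟨b, hb⟩
      have hi : ((equivShrink B).symm i).1 = b := by simp [i]
      have := isContractible_continuousComplex_trivial (F := sigmaDiagram F)
        (T := ((equivShrink B).symm i).1 ⋙ ι) (fun d y ↦ ⟨i, y⟩) (fun _ _ ↦ rfl)
      rwa [hi] at this) hT.1
  obtain ⟨i, hi⟩ := (h.isConnectedDiagram_of_isOrbit hT.1).exists_pointOf p d₀ F
    (fun d x ↦ f.app d x) (fun d d' φ x ↦ NatTrans.naturality_apply f φ x)
  exact ⟨_, ((equivShrink B).symm i).2, hi⟩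

/-- The size argument with the telescope as test diagram: `c` bounds the point sets of all members
of `B`, so maps from them contract to `top`, while the discrete wedge keeps its tautological map
apart from `top`. -/
lemma subsingleton_of_detectsContractibility [Small.{u} B]
    (hB : letI := topSpaceCategory ι; DetectsContractibility B) (hT : IsRegularOrbit T) (d : D) :
    Subsingleton (ι.obj (T.obj d)) := by
  obtain ⟨p⟩ := h.exists_pointOf hT
  suffices h : ∀ x, x = p.pt d from ⟨fun x y ↦ (h x).trans (h y).symm⟩
  intro x
  by_contra hx
  obtain ⟨c, hc, hc'⟩ := exists_cardinal.{u} (fun b : B ↦ Σ d, (b.1 ⋙ ι).obj d)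
  let W := wedge p (BigIndex c)
  have hW : IsConnectedDiagram W := isConnectedDiagram_wedge (h.isConnectedDiagram_of_isOrbit hT.1)
  have hU := h.isOrbit_discrete hW (wedgeBase p _) d
  obtain ⟨-, h'⟩ := h.exists_isWeakEquivalence hB (telescope p c) (fun b hb ↦
    isContractible_continuousComplex_telescope (hc' ⟨b, hb⟩)) hU
  let e := h.diagramIso (W ⋙ TopCat.discrete)
  obtain ⟨a, x, y, hxy⟩ := exists_hom_constant_ne (p := p) (c := c)
    (X := h.diagram (W ⋙ TopCat.discrete) ⋙ ι) (h.isConnectedDiagram_of_isOrbit hU)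
    (fun d ↦ (TopCat.homeoOfIso (e.app d)).symm.discreteTopology) (fun d y ↦ e.hom.app d y)
    (fun f y ↦ NatTrans.naturality_apply e.hom f y) (fun A ↦ by
      obtain ⟨w, hw⟩ := Wedge.exists_not_supp_subset hx A.ne_univ
      refine ⟨d, e.inv.app d w, fun hA ↦ hw ?_⟩
      have : e.hom.app d (e.inv.app d w) = w := TopCat.inv_hom_id_apply (e.app d) w
      exact (congrArg (Wedge.supp (p := p)) this).symm.subset.trans hA)
  exact hxy (h' a x y)

theorem isColocal [Small.{u} B] (hB : letI := topSpaceCategory ι; DetectsContractibility B)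
    (hT : IsRegularOrbit T) : letI := topSpaceCategory ι; IsColocal B T := by
  let _ := topSpaceCategory ι
  obtain ⟨b, hb, ⟨q⟩⟩ := h.exists_mem_pointOf hB hT
  obtain ⟨p⟩ := h.exists_pointOf hT
  have hT' := h.subsingleton_of_detectsContractibility hB hT
  refine isColocal_of_retract (h.spaceProperties.isCofibrant_of_isOrbit hT.1) hb
    { app := fun d ↦ h.fullyFaithful.preimage (TopCat.const (q.pt d))
      naturality := fun d d' f ↦ h.fullyFaithful.map_injective (TopCat.ext fun x ↦ ?_) }
    { app := fun d ↦ h.fullyFaithful.preimage (TopCat.const (p.pt d))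
      naturality := fun d d' f ↦ h.fullyFaithful.map_injective (TopCat.ext fun x ↦
        (hT' _).elim _ _) }
    (NatTrans.ext (funext fun d ↦ h.fullyFaithful.map_injective (TopCat.ext fun x ↦
      (hT' _).elim _ _)))
  simp only [Functor.map_comp, Functor.FullyFaithful.map_preimage]
  exact (q.map_pt f).symm

end

/-- Compactly generated spaces contain all Alexandrov-discrete spaces. -/
def compactlyGenerated : TopSpaces CompactlyGenerated.compactlyGeneratedToTop.{u, u} where
  fullyFaithful := CompactlyGenerated.fullyFaithfulCompactlyGeneratedToTop
  of X _ :=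
    haveI := deltaGeneratedSpace_of_alexandrovDiscrete X
    CompactlyGenerated.of X
  iso X _ := Iso.refl X

/-- Delta-generated spaces contain all Alexandrov-discrete spaces. -/
def deltaGenerated : TopSpaces DeltaGenerated.deltaGeneratedToTop.{u} where
  fullyFaithful := DeltaGenerated.fullyFaithfulDeltaGeneratedToTop
  of X _ :=
    haveI := deltaGeneratedSpace_of_alexandrovDiscrete X
    DeltaGenerated.of X
  iso X _ := Iso.refl X

end TopSpaces

end SpaceDiagram

end

open SpaceDiagram in
theorem lemma2p4 (D : Type u) [SmallCategory D] :
    (∀ B : Set (D ⥤ SSet.{u}), Small.{u} B → (∀ b ∈ B, IsCofibrant b) →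
      DetectsContractibility B →
      ∀ T : D ⥤ SSet.{u}, IsRegularOrbit T → IsColocal B T) ∧
    (∀ B : Set (D ⥤ CompactlyGenerated.{u, u}), Small.{u} B → (∀ b ∈ B, IsCofibrant b) →
      DetectsContractibility B →
      ∀ T : D ⥤ CompactlyGenerated.{u, u}, IsRegularOrbit T → IsColocal B T) ∧
    (∀ B : Set (D ⥤ DeltaGenerated.{u}), Small.{u} B → (∀ b ∈ B, IsCofibrant b) →
      DetectsContractibility B →
      ∀ T : D ⥤ DeltaGenerated.{u}, IsRegularOrbit T → IsColocal B T) :=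
  ⟨fun _ _ _ hB _ hT ↦ isColocal_sset hB hT,
    fun _ _ _ hB _ hT ↦ TopSpaces.compactlyGenerated.isColocal hB hT,
    fun _ _ _ hB _ hT ↦ TopSpaces.deltaGenerated.isColocal hB hT⟩
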